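/- Let $F$ be a number field of degree $d=[F:\mathbb{Q}]$ with ring of integers $O_F$. For a nonzero ideal $\mathfrak{a}$ of $O_F$ let $\mathcal{N}(\mathfrak{a})=[O_F:\mathfrak{a}]$, let $\mu(\mathfrak{a})=(-1)^{\omega(\mathfrak{a})}$ if $\mathfrak{a}$ is squarefree, where $\omega(\mathfrak{a})$ is the number of distinct prime factors of $\mathfrak{a}$, and $\mu(\mathfrak{a})=0$ otherwise, and let $\Lambda(\mathfrak{a})=\log\mathcal{N}(\mathfrak{p})$ if $\mathfrak{a}=\mathfrak{p}^k$ with $\mathfrak{p}$ a nonzero prime ideal and $k\ge 1$, and $\Lambda(\mathfrak{a})=0$ otherwise. For nonzero ideals $\mathfrak{a},\mathfrak{b}$ of $O_F$ define the Ramanujan sum $$C_{\mathfrak{a}}(\mathfrak{b})=\sum_{\mathfrak{d}\mid\mathfrak{a},\ \mathfrak{d}\mid\mathfrak{b}}\mathcal{N}(\mathfrak{d})\,\mu(\mathfrak{a}/\mathfrak{d}).$$ Let $$c_F=\frac{2^{r_1}(2\pi)^{r_2}\mathcal{R}h}{W\sqrt{D}},$$ where $r_1$ and $r_2$ are the numbers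 of real and complex places of $F$, $\mathcal{R}$ is the regulator, $h$ the class number, $W$ the number of roots of unity in $F$ and $D$ the absolute value of the discriminant. Then the following hold. (0) $c_F$ is the residue at $s=1$ of the Dedekind zeta function $\zeta_F(s)$: there is a function, meromorphic at $s=1$ and equal to $\zeta_F(s)$ for $\operatorname{Re}s>1$, whose product with $s-1$ tends to $c_F$ as $s\to 1$. (1) For every nonzero ideal $\mathfrak{a}$ with $\Lambda(\mathfrak{a})\neq 0$, the series $\sum_{\mathfrak{b}}C_{\mathfrak{a}}(\mathfrak{b})/\mathcal{N}(\mathfrak{b})$ over all nonzero ideals $\mathfrak{b}$ of $O_F$, summed in order of increasing norm (that is, as the limit for $x\to\infty$ of the sums over $\mathcal{N}(\mathfrak{b})\le x$), converges, and $$c_F=-\frac{1}{\Lambda(\mathfrak{a})}\sum_{\mathfrak{b}}\frac{C_{\mathfrak{a}}(\mathfrak{b})}{\mathcal{N}(\mathfrak{b})}.$$ (2) Let $\lambda>d+1$. Then, as $x\to\infty$ with $y\ge 1$ and $y^{\lambda}\ll x$, $$\sum_{\mathcal{N}(\mathfrak{b})\le x,\ \mathcal{N}(\mathfrak{a})\le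 y}C_{\mathfrak{a}}(\mathfrak{b})=c_Fx+o(x).$$ That is, for all $A>0$ and $\varepsilon>0$ there is an $X$ such that the left-hand side differs from $c_Fx$ by at most $\varepsilon x$ whenever $x\ge X$, $y\ge 1$ and $y^{\lambda}\le Ax$. -/

import Mathlib

open Filter Topology NumberField

noncomputable section

namespace NumberFieldRamanujan

theorem finite_idealsLE (F : Type*) [Field F] [NumberField F] (x : ℝ) :
    {I : Ideal (𝓞 F) | I ≠ ⊥ ∧ (Ideal.absNorm I : ℝ) ≤ x}.Finite := by
  refine (Ideal.finite_setOfPred_absNorm_le (S := 𝓞 F) ⌊x⌋₊).subset ?_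
  rintro I ⟨-, h⟩
  exact Nat.le_floor h

/-- The finite set of all nonzero ideals of `𝓞 F` of norm at most `x`. -/
def idealsLE (F : Type*) [Field F] [NumberField F] (x : ℝ) : Finset (Ideal (𝓞 F)) :=
  (finite_idealsLE F x).toFinset

theorem mem_idealsLE (F : Type*) [Field F] [NumberField F] (x : ℝ) (I : Ideal (𝓞 F)) :
    I ∈ idealsLE F x ↔ I ≠ ⊥ ∧ (Ideal.absNorm I : ℝ) ≤ x := by
  simp [idealsLE]

/-- The finite set of all pairs `(𝔡, 𝔢)` of ideals with `𝔡 𝔢 = 𝔞` and `𝔡 ∣ 𝔟` (for `𝔞 ≠ 0`), that is,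
of all common divisors `𝔡` of `𝔞` and `𝔟`, each together with its cofactor `𝔢 = 𝔞 / 𝔡`. -/
def commonDivisorPairs (F : Type*) [Field F] [NumberField F] (a b : Ideal (𝓞 F)) :
    Finset (Ideal (𝓞 F) × Ideal (𝓞 F)) :=
  open Classical in
  ((idealsLE F (Ideal.absNorm a)) ×ˢ (idealsLE F (Ideal.absNorm a))).filter
    (fun p => p.1 * p.2 = a ∧ p.1 ∣ b)

theorem mem_commonDivisorPairs (F : Type*) [Field F] [NumberField F] (a b : Ideal (𝓞 F))
    (ha : a ≠ ⊥) (p : Ideal (𝓞 F) × Ideal (𝓞 F)) :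
    p ∈ commonDivisorPairs F a b ↔ p.1 * p.2 = a ∧ p.1 ∣ b := by
  obtain ⟨d, e⟩ := p
  simp only [commonDivisorPairs, Finset.mem_filter, Finset.mem_product, mem_idealsLE,
    and_iff_right_iff_imp]
  rintro ⟨rfl, -⟩
  have hd : d ≠ ⊥ := by rintro rfl; simp at ha
  have he : e ≠ ⊥ := by rintro rfl; simp at ha
  have h1 : 1 ≤ Ideal.absNorm d := Nat.one_le_iff_ne_zero.2 (fun h => hd (Ideal.absNorm_eq_zero_iff.1 h))
  have h2 : 1 ≤ Ideal.absNorm e := Nat.one_le_iff_ne_zero.2 (fun h => he (Ideal.absNorm_eq_zero_iff.1 h))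
  rw [map_mul]
  refine ⟨⟨hd, ?_⟩, he, ?_⟩
  · exact_mod_cast Nat.le_mul_of_pos_right _ h2
  · exact_mod_cast Nat.le_mul_of_pos_left _ h1

/-- The Ramanujan sum `C_𝔞(𝔟) = ∑_{𝔡 ∣ 𝔞, 𝔡 ∣ 𝔟} 𝒩(𝔡) μ(𝔞 / 𝔡)` for nonzero ideals `𝔞`, `𝔟`,
where `μ` is Mathlib's Möbius function of the factorial monoid of ideals: `μ(𝔠) = (-1) ^ ω(𝔠)` if `𝔠` is
squarefree with `ω(𝔠)` prime factors, and `μ(𝔠) = 0` otherwise. -/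
def ramanujanSum (F : Type*) [Field F] [NumberField F] (a b : Ideal (𝓞 F)) : ℤ :=
  ∑ p ∈ commonDivisorPairs F a b, (Ideal.absNorm p.1 : ℤ) * UniqueFactorizationMonoid.moebius p.2

/-- The von Mangoldt function on nonzero ideals: `Λ(𝔭 ^ k) = log 𝒩(𝔭)` for `𝔭` a nonzero prime ideal
and `k ≥ 1` (the prime `𝔭` is the radical of `𝔭 ^ k`), and `Λ(𝔞) = 0` for every other `𝔞`. -/
def vonMangoldt (F : Type*) [Field F] [NumberField F] (a : Ideal (𝓞 F)) : ℝ :=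
  open Classical in
  if IsPrimePow a then Real.log (Ideal.absNorm a.radical) else 0

theorem vonMangoldt_prime_pow (F : Type*) [Field F] [NumberField F] (P : Ideal (𝓞 F))
    (hP : P.IsPrime) (hP0 : P ≠ ⊥) (k : ℕ) (hk : 0 < k) :
    vonMangoldt F (P ^ k) = Real.log (Ideal.absNorm P) := by
  have h : IsPrimePow (P ^ k) := ⟨P, k, Ideal.prime_of_isPrime hP0 hP, hk, rfl⟩
  rw [vonMangoldt, if_pos h, Ideal.radical_pow P hk.ne', hP.radical]

/-- `c` is the residue at `s = 1` of (the continuation of) the Dedekind zeta function of `F`, the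
pole being at most simple. -/
def IsDedekindZetaResidue (F : Type*) [Field F] [NumberField F] (c : ℂ) : Prop :=
  ∃ Z : ℂ → ℂ, MeromorphicAt Z 1 ∧ (∀ s : ℂ, 1 < s.re → Z s = dedekindZeta F s) ∧
    Tendsto (fun s : ℂ => (s - 1) * Z s) (𝓝[≠] 1) (𝓝 c)

end NumberFieldRamanujan

end

noncomputable section

/-! Everything rests on counting ideals with a power saving: the number of nonzero ideals of norm at
most `t` is `c t + O(t ^ (1 - 1/d))`, with `c` the class number formula constant
(`exists_abs_card_idealsLE_sub_le`). It is proved class by class: ideals in a class become lattice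
points in a dilate of `normLeOne F`, and the error is controlled because the frontier of that set is
covered by finitely many Lipschitz images of the boundary of a cube (`abs_card_mul_sub_le`,
`frontier_normLeOne_subset`).

For the residue, write `ζ_F` as a Mellin integral of the counting function. The main term `c t`
gives `c s / (s - 1)`, and the error gives a function holomorphic for `Re s > 1 - 1/d`
(`dedekindZeta_eq_mellin`).

For the series, with `q` the norm of `𝔭`, inserting the definition of `C_𝔞` and writing `𝔟 = 𝔡 𝔟'`
turns the partial sum for `𝔞 = 𝔭 ^ (k + 1)` into `H(x / q ^ (k + 1)) - H(x / q ^ k)`, where `H(t)`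
sums `1 / 𝒩(𝔟)` over norms at most `t`. By Abel summation `H(q u) - H(u)` tends to `c log q`, so the
sum tends to `-c Λ(𝔞)`.

For the double sum, the same insertion counts `𝔟'` up to `x / 𝒩(𝔡)`. The main terms are `c x` times
a sum of Möbius values in which only `𝔞 = 1` survives. The errors total `O(x ^ (1 - 1/d) y ^ (1 +
1/d) (1 + log y))`, which is `o(x)` when `y ^ λ ≪ x` with `λ > d + 1`. -/

namespace NumberFieldRamanujan

/-! ### Counting lattice points in dilates of a set with small frontier. -/

section LatticeCount

open MeasureTheory Metric Set Module
open scoped ENNReal NNReal Pointwise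

/-- The volume of the `δ`-neighbourhood of `s` is at most linear in `δ ≤ 1`. -/
def HasLinearNbhd {E : Type*} [PseudoMetricSpace E] [MeasurableSpace E] (μ : Measure E)
    (s : Set E) : Prop :=
  ∃ C : ℝ, 0 ≤ C ∧ ∀ δ : ℝ, 0 < δ → δ ≤ 1 →
    μ (⋃ p ∈ s, closedBall p δ) ≤ ENNReal.ofReal (C * δ)

theorem HasLinearNbhd.mono {E : Type*} [PseudoMetricSpace E] [MeasurableSpace E] {μ : Measure E}
    {s t : Set E} (ht : HasLinearNbhd μ t) (h : s ⊆ t) : HasLinearNbhd μ s := by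
  obtain ⟨C, hC, H⟩ := ht
  exact ⟨C, hC, fun δ h0 h1 => (measure_mono (biUnion_subset_biUnion_left h)).trans (H δ h0 h1)⟩

theorem HasLinearNbhd.iUnion {E : Type*} [PseudoMetricSpace E] [MeasurableSpace E]
    {μ : Measure E} {κ : Type*} [Fintype κ] {s : κ → Set E} (hs : ∀ k, HasLinearNbhd μ (s k)) :
    HasLinearNbhd μ (⋃ k, s k) := by
  choose C hC H using hs
  refine ⟨∑ k, C k, Finset.sum_nonneg fun k _ => hC k, fun δ h0 h1 => ?_⟩
  have : (⋃ p ∈ ⋃ k, s k, closedBall p δ) = ⋃ k, ⋃ p ∈ s k, closedBall p δ := by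
    ext x; simp only [mem_iUnion]; tauto
  rw [this, Finset.sum_mul, ENNReal.ofReal_sum_of_nonneg fun k _ => mul_nonneg (hC k) h0.le]
  exact (measure_iUnion_fintype_le μ _).trans (Finset.sum_le_sum fun k _ => H k δ h0 h1)

/-- The boundary of the unit cube. -/
def cubeBoundary (ι : Type*) : Set (ι → ℝ) :=
  {u | u ∈ Icc (0 : ι → ℝ) 1 ∧ ∃ i, u i = 0 ∨ u i = 1}

theorem card_boundary_grid_le (ι : Type*) [Fintype ι] [DecidableEq ι] (n : ℕ) :
    (Finset.univ.filter fun k : ι → Fin (n + 1) => ∃ i, k i = 0 ∨ k i = Fin.last n).card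
      ≤ Fintype.card ι * (2 * (n + 1) ^ (Fintype.card ι - 1)) := by
  have key : ∀ (i : ι) (c : Fin (n + 1)),
      (Fintype.piFinset fun j => if j = i then {c} else Finset.univ).card
        = (n + 1) ^ (Fintype.card ι - 1) := by
    intro i c
    rw [Fintype.card_piFinset, ← Finset.mul_prod_erase _ _ (Finset.mem_univ i)]
    rw [Finset.prod_congr rfl (g := fun _ => n + 1)]
    · simp [Finset.card_erase_of_mem]
    · intro j hj
      simp [Finset.ne_of_mem_erase hj]
  have hsub : (Finset.univ.filter fun k : ι → Fin (n + 1) => ∃ i, k i = 0 ∨ k i = Fin.last n) ⊆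
      Finset.univ.biUnion fun i : ι =>
        (Fintype.piFinset fun j => if j = i then {(0 : Fin (n + 1))} else Finset.univ) ∪
        (Fintype.piFinset fun j => if j = i then {Fin.last n} else Finset.univ) := by
    intro k hk
    obtain ⟨i, hi⟩ := (Finset.mem_filter.1 hk).2
    simp only [Finset.mem_biUnion, Finset.mem_union, Fintype.mem_piFinset, Finset.mem_univ,
      true_and]
    refine ⟨i, hi.imp (fun h j => ?_) (fun h j => ?_)⟩ <;>
    · by_cases hj : j = i
      · subst hj; simp [h]
      · simp [hj]
  refine (Finset.card_le_card hsub).trans (Finset.card_biUnion_le.trans ?_)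
  rw [← smul_eq_mul, ← Finset.card_univ, ← Finset.sum_const]
  refine Finset.sum_le_sum fun i _ => (Finset.card_union_le _ _).trans ?_
  rw [key, key, Finset.card_univ]
  lia

/-- In dimension `m + 1`, the boundary of the cube lies within `δ` of `O(δ ^ (-m))` grid points.
Their images carry balls of radius `(K + 1) δ`, each of volume `O(δ ^ (m + 1))`. -/
theorem hasLinearNbhd_image_cubeBoundary {ι E : Type*} [Fintype ι] [NormedAddCommGroup E]
    [NormedSpace ℝ E] [FiniteDimensional ℝ E] [MeasurableSpace E] [BorelSpace E] (μ : Measure E)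
    [μ.IsAddHaarMeasure] (hd : finrank ℝ E = Fintype.card ι) {K : ℝ≥0} {f : (ι → ℝ) → E}
    (hf : LipschitzOnWith K f (Icc 0 1)) : HasLinearNbhd μ (f '' cubeBoundary ι) := by
  classical
  rcases isEmpty_or_nonempty ι with hι | hι
  · refine ⟨0, le_rfl, fun δ _ _ => ?_⟩
    simp [cubeBoundary]
  obtain ⟨m, hm⟩ : ∃ m, Fintype.card ι = m + 1 :=
    ⟨Fintype.card ι - 1, (Nat.sub_add_cancel Fintype.card_pos).symm⟩
  set B := (μ (ball 0 1)).toReal with hB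
  have hBt : μ (ball 0 1) = ENNReal.ofReal B :=
    (ENNReal.ofReal_toReal measure_ball_lt_top.ne).symm
  refine ⟨(m + 1) * (2 * 3 ^ m) * (K + 1) ^ (m + 1) * B, by positivity, fun δ h0 h1 => ?_⟩
  -- The mesh `1 / n` is at most `δ`, while `δ ≤ 1` gives `n + 1 ≤ 3 / δ`: the source of the factor
  -- `3 ^ m`.
  set n := ⌈1 / δ⌉₊ with hn
  have hnpos : 0 < n := Nat.ceil_pos.2 (by positivity)
  have hn0 : (0 : ℝ) < n := Nat.cast_pos.2 hnpos
  have hn1 : 1 / δ ≤ n := Nat.le_ceil _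
  have hn2 : (n : ℝ) + 1 ≤ 3 / δ := by
    have h2 := (Nat.ceil_lt_add_one (a := 1 / δ) (by positivity)).le
    have : 1 ≤ 1 / δ := by rw [le_div_iff₀ h0]; linarith
    have h3 : 3 / δ = 3 * (1 / δ) := by ring
    linarith
  have hn3 : 1 / (n : ℝ) ≤ δ := by
    rw [div_le_iff₀ hn0]; rw [div_le_iff₀ h0] at hn1; linarith
  set T := Finset.univ.filter fun k : ι → Fin (n + 1) => ∃ i, k i = 0 ∨ k i = Fin.last n with hT
  let g : (ι → Fin (n + 1)) → (ι → ℝ) := fun k i => (k i : ℝ) / n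
  have hsub : (⋃ p ∈ f '' cubeBoundary ι, closedBall p δ) ⊆
      ⋃ k ∈ T, closedBall (f (g k)) ((K + 1) * δ) := by
    intro x hx
    simp only [mem_iUnion, mem_image, exists_prop] at hx
    obtain ⟨_, ⟨u, ⟨hu, i, hi⟩, rfl⟩, hx⟩ := hx
    have hu0 : ∀ j, 0 ≤ u j := hu.1
    have hu1 : ∀ j, u j ≤ 1 := hu.2
    have hlt : ∀ j, ⌊n * u j⌋₊ < n + 1 := fun j => by
      rw [Nat.lt_succ_iff]
      refine Nat.floor_le_of_le ?_
      nlinarith [hu1 j]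
    -- Rounding down fixes the coordinates `0` and `1`, so the grid point stays on the boundary.
    let k : ι → Fin (n + 1) := fun j => ⟨⌊n * u j⌋₊, hlt j⟩
    have hk : k ∈ T := by
      refine Finset.mem_filter.2 ⟨Finset.mem_univ _, i, hi.imp (fun h => ?_) (fun h => ?_)⟩
      · ext; simp [k, h]
      · ext; simp [k, h]
    have hgk : g k ∈ Icc (0 : ι → ℝ) 1 := by
      refine ⟨fun j => ?_, fun j => ?_⟩
      · simp only [g, Pi.zero_apply]; positivity
      · simp only [g, Pi.one_apply]
        rw [div_le_one hn0]
        exact_mod_cast Nat.lt_succ_iff.1 (k j).2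
    have hdist : dist u (g k) ≤ δ := by
      refine (dist_pi_le_iff h0.le).2 fun j => ?_
      refine le_trans ?_ hn3
      have e1 : (⌊n * u j⌋₊ : ℝ) ≤ n * u j := Nat.floor_le (mul_nonneg hn0.le (hu0 j))
      have e2 : n * u j < ⌊n * u j⌋₊ + 1 := Nat.lt_floor_add_one _
      have e3 : u j - g k j = (n * u j - ⌊n * u j⌋₊) / n := by
        simp only [g, k]; field_simp
      rw [Real.dist_eq, e3, abs_of_nonneg (div_nonneg (by linarith) hn0.le)]
      gcongr
      linarith
    simp only [mem_iUnion, exists_prop]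
    refine ⟨k, hk, ?_⟩
    rw [mem_closedBall] at hx ⊢
    have h4 := hf.dist_le_mul u hu (g k) hgk
    have h5 : (K : ℝ) * dist u (g k) ≤ K * δ := by gcongr
    linarith [dist_triangle x (f u) (f (g k))]
  refine (measure_mono hsub).trans ((measure_biUnion_finset_le _ _).trans ?_)
  have hball : ∀ k ∈ T, μ (closedBall (f (g k)) ((K + 1) * δ)) =
      ENNReal.ofReal (((K + 1) * δ) ^ (m + 1) * B) := fun k _ => by
    rw [Measure.addHaar_closedBall _ _ (by positivity), hd, hm, hBt,
      ← ENNReal.ofReal_mul (by positivity)]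
  rw [Finset.sum_congr rfl hball, Finset.sum_const, nsmul_eq_mul, ← ENNReal.ofReal_natCast,
    ← ENNReal.ofReal_mul (Nat.cast_nonneg _)]
  refine ENNReal.ofReal_le_ofReal ?_
  have hcard : (T.card : ℝ) ≤ (m + 1) * (2 * (3 / δ) ^ m) := by
    have := card_boundary_grid_le ι n
    rw [hm, Nat.add_sub_cancel] at this
    calc (T.card : ℝ) ≤ (m + 1) * (2 * ((n : ℝ) + 1) ^ m) := by exact_mod_cast this
      _ ≤ _ := by gcongr
  calc (T.card : ℝ) * (((K + 1) * δ) ^ (m + 1) * B)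
      ≤ ((m + 1) * (2 * (3 / δ) ^ m)) * (((K + 1) * δ) ^ (m + 1) * B) := by gcongr
    _ = _ := by
      rw [div_pow, mul_pow, pow_succ δ]
      field_simp

/-- A segment from `s` to its complement that missed the frontier would be disconnected by the
interior of `s` and the complement of its closure. -/
theorem exists_mem_frontier_dist_le {E : Type*} [NormedAddCommGroup E] [NormedSpace ℝ E]
    {s : Set E} {x y : E} (hx : x ∈ s) (hy : y ∉ s) :
    ∃ p ∈ frontier s, dist x p ≤ dist x y ∧ dist y p ≤ dist x y := by
  obtain ⟨p, hp, hpf⟩ : (segment ℝ x y ∩ frontier s).Nonempty := by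
    by_contra h
    rw [not_nonempty_iff_eq_empty, ← disjoint_iff_inter_eq_empty, Set.disjoint_left] at h
    have hx' : x ∈ interior s := by
      by_contra hc
      exact h (left_mem_segment ℝ x y) ⟨subset_closure hx, hc⟩
    have hy' : y ∈ (closure s)ᶜ := fun hc =>
      h (right_mem_segment ℝ x y) ⟨hc, fun hi => hy (interior_subset hi)⟩
    obtain ⟨z, -, hz1, hz2⟩ := (convex_segment x y).isPreconnected _ _ isOpen_interior
      isClosed_closure.isOpen_compl
      (fun z hz => or_iff_not_imp_left.2 fun hi hc => h hz ⟨hc, hi⟩)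
      ⟨x, left_mem_segment ℝ x y, hx'⟩ ⟨y, right_mem_segment ℝ x y, hy'⟩
    exact hz2 (interior_subset_closure hz1)
  refine ⟨p, hpf, ?_, ?_⟩
  · have := dist_add_dist_of_mem_segment hp
    linarith [dist_nonneg (x := p) (y := y)]
  · have := dist_add_dist_of_mem_segment hp
    rw [dist_comm y p]
    linarith [dist_nonneg (x := x) (y := p)]

/-- Attach to each lattice point of `s` its translate of the fundamental domain. The translates are
disjoint, and a point lying in only one of `s` and their union `U` is within `R` of the frontier,
since it and its lattice point are on different sides. -/
theorem abs_card_mul_sub_le {E ι : Type*} [Fintype ι] [NormedAddCommGroup E]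
    [NormedSpace ℝ E] [FiniteDimensional ℝ E] [MeasurableSpace E] [BorelSpace E] (μ : Measure E)
    [μ.IsAddHaarMeasure] (b : Basis ι ℝ E) {R : ℝ}
    (hR : ∀ z ∈ ZSpan.fundamentalDomain b, ‖z‖ ≤ R)
    {s : Set E} (hb : Bornology.IsBounded s)
    {m : ℝ} (hm0 : 0 ≤ m) (hm : μ (⋃ p ∈ frontier s, closedBall p R) ≤ ENNReal.ofReal m) :
    |(Nat.card (s ∩ Submodule.span ℤ (range b) : Set E) : ℝ) * μ.real (ZSpan.fundamentalDomain b)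
      - μ.real s| ≤ m := by
  set D := ZSpan.fundamentalDomain b with hD
  have hPfin : (s ∩ Submodule.span ℤ (range b) : Set E).Finite := ZSpan.setFinite_inter b hb
  have := hPfin.to_subtype
  have hDm : MeasurableSet D := ZSpan.fundamentalDomain_measurableSet b
  set P := (s ∩ Submodule.span ℤ (range b) : Set E) with hP
  set U := ⋃ l : P, (l : E) +ᵥ D with hU
  have hmem : ∀ (l x : E), x ∈ l +ᵥ D ↔ x - l ∈ D := fun l x => by
    rw [mem_vadd_set_iff_neg_vadd_mem, vadd_eq_add, neg_add_eq_sub]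
  have hdisj : Pairwise (Function.onFun Disjoint fun l : P => (l : E) +ᵥ D) := by
    intro l l' hll
    refine Set.disjoint_left.2 fun x hx hx' => hll ?_
    rw [hmem] at hx hx'
    have h1 := ZSpan.exist_unique_vadd_mem_fundamentalDomain b x
    have h2 := h1.unique (y₁ := ⟨-l, neg_mem l.2.2⟩) (y₂ := ⟨-l', neg_mem l'.2.2⟩)
      (by rw [Submodule.vadd_def, vadd_eq_add, neg_add_eq_sub]; exact hx)
      (by rw [Submodule.vadd_def, vadd_eq_add, neg_add_eq_sub]; exact hx')
    simpa [Subtype.ext_iff] using h2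
  have hDfin : μ D ≠ ⊤ := (ZSpan.fundamentalDomain_isBounded b).measure_lt_top.ne
  have hUmeas : μ U = Nat.card P * μ D := by
    rw [hU, measure_iUnion hdisj fun l => hDm.const_vadd _]
    simp [measure_vadd, ENNReal.tsum_const, ← coe_ncard_eq_encard]
  have hUfin : μ U ≠ ⊤ := by rw [hUmeas]; exact ENNReal.mul_ne_top (by simp) hDfin
  have hsfin : μ s ≠ ⊤ := hb.measure_lt_top.ne
  have h1 : U \ s ⊆ ⋃ p ∈ frontier s, closedBall p R := by
    rintro y ⟨hy, hys⟩
    obtain ⟨l, hl⟩ := mem_iUnion.1 hy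
    rw [hmem] at hl
    obtain ⟨p, hp, -, h2⟩ := exists_mem_frontier_dist_le l.2.1 hys
    refine mem_iUnion₂.2 ⟨p, hp, mem_closedBall.2 (h2.trans ?_)⟩
    rw [dist_comm, dist_eq_norm]
    exact hR _ hl
  have h2 : s \ U ⊆ ⋃ p ∈ frontier s, closedBall p R := by
    rintro y ⟨hys, hy⟩
    have hfr : y - ZSpan.floor b y ∈ D := ZSpan.fract_mem_fundamentalDomain b y
    have hfl : (ZSpan.floor b y : E) ∉ s := fun h => hy <|
      mem_iUnion.2 ⟨⟨ZSpan.floor b y, h, (ZSpan.floor b y).2⟩, (hmem _ _).2 hfr⟩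
    obtain ⟨p, hp, h2, -⟩ := exists_mem_frontier_dist_le hys hfl
    refine mem_iUnion₂.2 ⟨p, hp, mem_closedBall.2 (h2.trans ?_)⟩
    rw [dist_eq_norm]
    exact hR _ hfr
  have hreal : (Nat.card P : ℝ) * μ.real D = μ.real U := by
    rw [measureReal_def, measureReal_def, hUmeas, ENNReal.toReal_mul, ENNReal.toReal_natCast]
  have hle : ∀ t, t ⊆ (⋃ p ∈ frontier s, closedBall p R) → μ.real t ≤ m := fun t ht =>
    ENNReal.toReal_le_of_le_ofReal hm0 ((measure_mono ht).trans hm)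
  have h3 := hle _ h1
  have h4 := hle _ h2
  have h5 := le_measureReal_sdiff (μ := μ) (s₁ := s) (s₂ := U) hUfin
  have h6 := le_measureReal_sdiff (μ := μ) (s₁ := U) (s₂ := s) hsfin
  rw [hreal, abs_le]
  constructor <;> linarith

/-- The `R`-neighbourhood of the frontier of `r • s` is contained in `r` times the `R /
r`-neighbourhood of that of `s`, so one power of `r` is saved. Taking `r₀ = R` ensures `R / r ≤ 1`.
-/
theorem exists_abs_card_smul_sub_le {E ι : Type*} [Fintype ι] [NormedAddCommGroup E]
    [NormedSpace ℝ E] [FiniteDimensional ℝ E] [Nontrivial E] [MeasurableSpace E] [BorelSpace E]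
    (μ : Measure E) [μ.IsAddHaarMeasure] (b : Basis ι ℝ E) {s : Set E}
    (hb : Bornology.IsBounded s) (hf : HasLinearNbhd μ (frontier s)) :
    ∃ C r₀ : ℝ, 0 ≤ C ∧ 0 < r₀ ∧ ∀ r : ℝ, r₀ ≤ r →
      |(Nat.card (r • s ∩ Submodule.span ℤ (range b) : Set E) : ℝ)
        - μ.real s / μ.real (ZSpan.fundamentalDomain b) * r ^ finrank ℝ E|
          ≤ C * r ^ (finrank ℝ E - 1) := by
  obtain ⟨C, hC, H⟩ := hf
  obtain ⟨R, hR0, hR⟩ := (ZSpan.fundamentalDomain_isBounded b).exists_pos_norm_le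
  set D := ZSpan.fundamentalDomain b with hD
  have hv : 0 < μ.real D := by
    refine ENNReal.toReal_pos (ZSpan.measure_fundamentalDomain_ne_zero b)
      (ZSpan.fundamentalDomain_isBounded b).measure_lt_top.ne
  refine ⟨C * R / μ.real D, R, by positivity, hR0, fun r hr => ?_⟩
  have hr0 : 0 < r := hR0.trans_le hr
  obtain ⟨k, hk⟩ : ∃ k, finrank ℝ E = k + 1 :=
    ⟨finrank ℝ E - 1, (Nat.sub_add_cancel finrank_pos).symm⟩
  have hfr : (⋃ p ∈ frontier (r • s), closedBall p R) ⊆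
      r • ⋃ p ∈ frontier s, closedBall p (R / r) := by
    intro x hx
    obtain ⟨p, hp, hx⟩ := mem_iUnion₂.1 hx
    have hp' : p ∈ r • frontier s := by
      have : r • frontier s = frontier (r • s) := (Homeomorph.smulOfNeZero r hr0.ne').image_frontier s
      rwa [this]
    rw [mem_smul_set_iff_inv_smul_mem₀ hr0.ne'] at hp' ⊢
    refine mem_iUnion₂.2 ⟨_, hp', ?_⟩
    rw [mem_closedBall] at hx ⊢
    rw [dist_smul₀, norm_inv, Real.norm_of_nonneg hr0.le, ← div_eq_inv_mul]
    gcongr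
  have hm : μ (⋃ p ∈ frontier (r • s), closedBall p R) ≤
      ENNReal.ofReal (C * R * r ^ k) := by
    refine (measure_mono hfr).trans ?_
    rw [Measure.addHaar_smul, hk, abs_of_nonneg (by positivity)]
    calc _ ≤ ENNReal.ofReal (r ^ (k + 1)) * ENNReal.ofReal (C * (R / r)) := by
          gcongr
          exact H _ (by positivity) ((div_le_one hr0).2 hr)
      _ = _ := by
          rw [← ENNReal.ofReal_mul (by positivity)]
          congr 1
          rw [pow_succ]
          field_simp
  have := abs_card_mul_sub_le μ b hR (hb.smul₀ r) (by positivity) hm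
  rw [measureReal_def (s := r • s), Measure.addHaar_smul, ENNReal.toReal_mul,
    ENNReal.toReal_ofReal (abs_nonneg _), abs_of_nonneg (a := r ^ _) (by positivity), ← hD] at this
  rw [hk, Nat.add_sub_cancel]
  rw [hk] at this
  rw [div_mul_eq_mul_div, div_mul_eq_mul_div, le_div_iff₀ hv, ← abs_of_pos hv, ← abs_mul,
    abs_of_pos hv, sub_mul, div_mul_cancel₀ _ hv.ne', mul_comm (μ.real s)]
  exact this

end LatticeCount

/-! ### A Lipschitz parametrization of the frontier of `normLeOne F`. -/

section FundamentalCone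

open MeasureTheory Metric Set Module
open NumberField.InfinitePlace NumberField.mixedEmbedding NumberField.Units
  NumberField.Units.dirichletUnitTheorem NumberField.mixedEmbedding.fundamentalCone

variable (F : Type*) [Field F] [NumberField F]

/-- The index set of the real coordinates on the mixed space: radii and angles. -/
abbrev ConeIndex := InfinitePlace F ⊕ {w : InfinitePlace F // IsComplex w}

open scoped Classical in
/-- The moduli part of the parametrization of the closure of `normLeOne F`. -/
def coneRadius (u : ConeIndex F → ℝ) : realSpace F :=
  -- The coordinate at `w₀` is the scaling factor itself instead of its logarithm. It may thus take
  -- the value `0`, and the parameters range over a compact cube.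
  u (.inl w₀) • expMapBasis fun i => if i = w₀ then 0 else u (.inl i)

/-- The parametrization of the closure of `normLeOne F`, for each choice of signs at the real
places. -/
def coneParam (σ : {w : InfinitePlace F // IsReal w} → Bool) (u : ConeIndex F → ℝ) :
    mixedSpace F :=
  (fun w => (if σ w then 1 else -1) * coneRadius F u w,
    fun w => (coneRadius F u w : ℂ) * Complex.exp ((Real.pi * (2 * u (.inr w) - 1) : ℝ) * Complex.I))

open scoped Classical in
theorem contDiff_coneRadius : ContDiff ℝ 1 (coneRadius F) := by
  have h : ContDiff ℝ 1 (expMapBasis : realSpace F → realSpace F) := by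
    have h1 : ContDiff ℝ 1 (expMap : realSpace F → realSpace F) := by
      refine contDiff_pi.2 fun w => ?_
      simp only [expMap_apply]
      fun_prop
    exact h1.comp (completeBasis F).equivFunL.symm.contDiff
  unfold coneRadius
  refine ContDiff.smul (contDiff_apply ℝ ℝ _) (h.comp (contDiff_pi.2 fun i => ?_))
  split_ifs <;> fun_prop

open scoped Classical in
theorem contDiff_coneParam (σ : {w : InfinitePlace F // IsReal w} → Bool) :
    ContDiff ℝ 1 (coneParam F σ) := by
  have h := contDiff_coneRadius F
  have h' : ∀ w, ContDiff ℝ 1 fun u => coneRadius F u w := contDiff_pi.1 h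
  refine ContDiff.prodMk (contDiff_pi.2 fun w => contDiff_const.mul (h' w))
    (contDiff_pi.2 fun w => ContDiff.mul ?_ ?_)
  · exact Complex.ofRealCLM.contDiff.comp (h' w)
  · refine ContDiff.cexp (ContDiff.mul ?_ contDiff_const)
    exact Complex.ofRealCLM.contDiff.comp
      (f := fun u : ConeIndex F → ℝ => Real.pi * (2 * u (.inr w) - 1)) (by fun_prop)

open scoped Classical in
theorem card_coneIndex : finrank ℝ (mixedSpace F) = Fintype.card (ConeIndex F) := by
  rw [mixedEmbedding.finrank, Fintype.card_sum, ← card_add_two_mul_card_eq_rank,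
    card_eq_nrRealPlaces_add_nrComplexPlaces]
  simp only [nrComplexPlaces]
  ring

/-- Points of the closure have parameters in the closed cube. If none of these is `0` or `1`, the
point is interior, so frontier points come from the boundary of the cube. -/
theorem frontier_normLeOne_subset :
    frontier (normLeOne F) ⊆ ⋃ σ, coneParam F σ '' cubeBoundary (ConeIndex F) := by
  classical
  rintro x ⟨hx, hxi⟩
  obtain ⟨c, hc, _, ⟨a, ha, rfl⟩, hxa⟩ := closure_normLeOne_subset F hx
  have ha0 : a w₀ = 0 := by simpa using ha w₀ (mem_univ _)
  have ha1 : ∀ w, w ≠ w₀ → a w ∈ Icc (0 : ℝ) 1 := fun w hw => by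
    simpa [hw] using ha w (mem_univ _)
  let u : ConeIndex F → ℝ := Sum.elim (fun w => if w = w₀ then c else a w)
    fun w => (Complex.arg (x.2 w) / Real.pi + 1) / 2
  have hrad : coneRadius F u = normAtAllPlaces x := by
    rw [← hxa]
    simp only [coneRadius, u, Sum.elim_inl, if_true]
    congr 2
    ext i
    split_ifs with h
    · rw [h, ha0]
    · rfl
  have hu : u ∈ Icc (0 : ConeIndex F → ℝ) 1 := by
    have : ∀ i, u i ∈ Icc (0 : ℝ) 1 := by
      rintro (w | w)
      · simp only [u, Sum.elim_inl]
        split_ifs with h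
        exacts [hc, ha1 w h]
      · simp only [u, Sum.elim_inr]
        have h1 := Complex.neg_pi_lt_arg (x.2 w)
        have h2 := Complex.arg_le_pi (x.2 w)
        have h3 : -1 ≤ Complex.arg (x.2 w) / Real.pi := by
          rw [le_div_iff₀ Real.pi_pos]; linarith
        have h4 : Complex.arg (x.2 w) / Real.pi ≤ 1 := by
          rw [div_le_one Real.pi_pos]; exact h2
        constructor <;> linarith
    exact ⟨fun i => (this i).1, fun i => (this i).2⟩
  refine mem_iUnion.2 ⟨fun w => decide (0 ≤ x.1 w), u, ⟨hu, ?_⟩, ?_⟩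
  · by_contra! hne
    have hlt : ∀ i, u i ∈ Ioo (0 : ℝ) 1 := fun i =>
      ⟨lt_of_le_of_ne (hu.1 i) (hne i).1.symm, lt_of_le_of_ne (hu.2 i) (hne i).2⟩
    have hc' : c ∈ Ioo (0 : ℝ) 1 := by simpa [u] using hlt (.inl w₀)
    refine hxi (subset_interior_normLeOne F ?_)
    -- With `c > 0`, the scaling factor returns to the logarithmic coordinate at `w₀`, where `c < 1`
    -- means a negative value.
    refine ⟨fun w => if w = w₀ then Real.log c else a w, ?_, ?_⟩
    · rw [interior_paramSet]
      intro w _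
      by_cases h : w = w₀
      · simpa [h] using Real.log_neg hc'.1 hc'.2
      · simpa [h, u] using hlt (.inl w)
    · rw [← hxa, expMapBasis_apply'', if_pos rfl, Real.exp_log hc'.1]
      show _ = c • expMapBasis a
      congr 2
      ext w
      split_ifs with h
      · rw [h, ha0]
      · rfl
  · refine Prod.ext (funext fun w => ?_) (funext fun w => ?_)
    · simp only [coneParam, hrad, normAtAllPlaces_apply, normAtPlace_apply_of_isReal w.2]
      by_cases h : 0 ≤ x.1 w
      · simp [h, abs_of_nonneg h]
      · simp [h, abs_of_neg (not_le.1 h)]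
    · simp only [coneParam, hrad, normAtAllPlaces_apply, normAtPlace_apply_of_isComplex w.2]
      have : Real.pi * (2 * u (.inr w) - 1) = Complex.arg (x.2 w) := by
        simp only [u, Sum.elim_inr]
        field_simp
        ring
      rw [this]
      exact Complex.norm_mul_exp_arg_mul_I _

open scoped Classical in
theorem hasLinearNbhd_frontier_normLeOne :
    HasLinearNbhd volume (frontier (normLeOne F)) := by
  refine (HasLinearNbhd.iUnion fun σ => ?_).mono (frontier_normLeOne_subset F)
  obtain ⟨K, hK⟩ := ((contDiff_coneParam F σ).locallyLipschitz.locallyLipschitzOn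
    (s := Icc 0 1)).exists_lipschitzOnWith_of_compact isCompact_Icc
  exact hasLinearNbhd_image_cubeBoundary volume (card_coneIndex F) hK

end FundamentalCone

/-! ### Counting ideals, class by class and in total. -/

section IdealCount

open MeasureTheory Metric Set Module Ideal
open NumberField.InfinitePlace NumberField.mixedEmbedding NumberField.Units
  NumberField.mixedEmbedding.fundamentalCone
open scoped nonZeroDivisors Pointwise Real

variable (F : Type*) [Field F] [NumberField F]

/-- Multiplication by `J` is the bijection: it makes the class trivial and multiplies the norm by
that of `J`. -/
theorem card_class_eq_card_principal {C : ClassGroup (𝓞 F)} {J : (Ideal (𝓞 F))⁰}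
    (hJ : ClassGroup.mk0 J = C⁻¹) (s : ℝ) :
    Nat.card {I : (Ideal (𝓞 F))⁰ // absNorm (I : Ideal (𝓞 F)) ≤ s ∧ ClassGroup.mk0 I = C}
      = Nat.card {I : (Ideal (𝓞 F))⁰ // (J : Ideal (𝓞 F)) ∣ I ∧
        Submodule.IsPrincipal (I : Ideal (𝓞 F)) ∧
        absNorm (I : Ideal (𝓞 F)) ≤ s * absNorm (J : Ideal (𝓞 F))} := by
  simp_rw [← nonZeroDivisors_dvd_iff_dvd_coe]
  refine Nat.card_congr ?_
  refine ((Equiv.dvd J).subtypeEquiv fun I ↦ ?_).trans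
    (Equiv.subtypeSubtypeEquivSubtypeInter (fun I : (Ideal (𝓞 F))⁰ ↦ J ∣ I) _)
  rw [← ClassGroup.mk0_eq_one_iff (SetLike.coe_mem _)]
  simp_rw [Equiv.dvd_apply, Submonoid.coe_mul, ← Submonoid.mul_def, _root_.map_mul, hJ,
    inv_mul_eq_one, Nat.cast_mul, mul_comm s, eq_comm, and_comm, and_congr_left_iff]
  exact fun _ ↦
    (mul_le_mul_iff_of_pos_left (Nat.cast_pos.mpr (absNorm_pos_of_nonZeroDivisors J))).symm

theorem smul_normLeOne {r : ℝ} (hr : 0 < r) :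
    r • normLeOne F =
      {x | x ∈ fundamentalCone F ∧ mixedEmbedding.norm x ≤ r ^ finrank ℚ F} := by
  ext x
  rw [mem_smul_set_iff_inv_smul_mem₀ hr.ne', mem_normLeOne, smul_mem_iff_mem (inv_ne_zero hr.ne'),
    mixedEmbedding.norm_smul, abs_of_pos (inv_pos.2 hr), inv_pow, inv_mul_le_iff₀ (by positivity),
    mul_one]
  rfl

theorem card_idealSet_eq (J : (Ideal (𝓞 F))⁰) {r : ℝ} (hr : 0 < r) :
    Nat.card {a : idealSet F J // mixedEmbedding.norm (a : mixedSpace F) ≤ r ^ finrank ℚ F} =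
      Nat.card (r • normLeOne F ∩ Submodule.span ℤ
        (range (fractionalIdealLatticeBasis F (FractionalIdeal.mk0 F J))) : Set (mixedSpace F)) := by
  rw [smul_normLeOne F hr, span_idealLatticeBasis]
  refine Nat.card_congr ((Equiv.subtypeSubtypeEquivSubtypeInter _
    (mixedEmbedding.norm · ≤ r ^ finrank ℚ F)).trans (Equiv.subtypeEquivRight fun x => ?_))
  simp only [idealSet, mem_inter_iff, Set.mem_ofPred_eq]
  tauto

/-- Principal multiples of `J` correspond to lattice points of the cone, each counted `torsionOrder
F` times. The dilation `r` satisfies `r ^ n = s N` with `N` the norm of `J`, and this `N` cancels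
the one in the covolume. -/
theorem exists_abs_card_class_sub_le (C : ClassGroup (𝓞 F)) :
    ∃ B s₀ : ℝ, 0 ≤ B ∧ 0 < s₀ ∧ ∀ s : ℝ, s₀ ≤ s →
      |(Nat.card {I : (Ideal (𝓞 F))⁰ //
          absNorm (I : Ideal (𝓞 F)) ≤ s ∧ ClassGroup.mk0 I = C} : ℝ)
        - (2 ^ nrRealPlaces F * (2 * π) ^ nrComplexPlaces F * regulator F) /
            (torsionOrder F * Real.sqrt |discr F|) * s|
        ≤ B * s ^ (1 - 1 / (finrank ℚ F : ℝ)) := by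
  classical
  obtain ⟨J, hJ⟩ := ClassGroup.mk0_surjective C⁻¹
  have : Nontrivial (mixedSpace F) := by
    refine Module.nontrivial_of_finrank_pos (R := ℝ) ?_
    rw [mixedEmbedding.finrank]; exact finrank_pos
  obtain ⟨B, r₀, hB, hr₀, H⟩ := exists_abs_card_smul_sub_le volume
    (fractionalIdealLatticeBasis F (FractionalIdeal.mk0 F J)) (isBounded_normLeOne F)
    (hasLinearNbhd_frontier_normLeOne F)
  rw [mixedEmbedding.finrank] at H
  set n := finrank ℚ F with hn
  have hn0 : 0 < n := finrank_pos
  have hn1 : (n : ℝ) ≠ 0 := Nat.cast_ne_zero.2 hn0.ne'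
  set N : ℝ := ((absNorm (J : Ideal (𝓞 F)) : ℕ) : ℝ) with hN
  have hN0 : 0 < N := Nat.cast_pos.mpr (absNorm_pos_of_nonZeroDivisors J)
  set W : ℝ := ((torsionOrder F : ℕ) : ℝ) with hW
  have hW0 : 0 < W := Nat.cast_pos.mpr (torsionOrder_pos F)
  have hD0 : 0 < Real.sqrt |(discr F : ℝ)| := by
    refine Real.sqrt_pos_of_pos (abs_pos.mpr (Int.cast_ne_zero.mpr (discr_ne_zero F)))
  refine ⟨B * N ^ (1 - 1 / (n : ℝ)) / W, r₀ ^ n / N, by positivity, by positivity,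
    fun s hs => ?_⟩
  have hs0 : 0 < s := lt_of_lt_of_le (by positivity) hs
  have hsN : 0 < s * N := by positivity
  set r := (s * N) ^ (1 / (n : ℝ)) with hr
  have hr0 : 0 < r := Real.rpow_pos_of_pos hsN _
  have hrn : r ^ n = s * N := by
    rw [hr, ← Real.rpow_natCast, ← Real.rpow_mul hsN.le, one_div, inv_mul_cancel₀ hn1,
      Real.rpow_one]
  have hrn' : r ^ (n - 1) = (s * N) ^ (1 - 1 / (n : ℝ)) := by
    rw [hr, ← Real.rpow_natCast, ← Real.rpow_mul hsN.le, Nat.cast_sub hn0]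
    congr 1
    field_simp
    simp
  have hrr : r₀ ≤ r := by
    rw [div_le_iff₀ hN0, ← hrn] at hs
    exact le_of_pow_le_pow_left₀ hn0.ne' hr0.le hs
  have h1 := H r hrr
  rw [← card_idealSet_eq F J hr0, ← hn, hrn, hrn', ← card_isPrincipal_dvd_norm_le F J,
    ← card_class_eq_card_principal F hJ, Nat.cast_mul, ← hW, measureReal_def, volume_normLeOne,
    ← ZLattice.covolume_eq_measure_fundamentalDomain _ _ (fundamentalDomain_idealLattice F _),
    covolume_idealLattice, FractionalIdeal.coe_mk0, FractionalIdeal.coeIdeal_absNorm,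
    Rat.cast_natCast, ← hN, ENNReal.toReal_mul,
    ENNReal.toReal_mul, ENNReal.toReal_pow, ENNReal.toReal_pow, ENNReal.toReal_ofNat,
    ENNReal.coe_toReal, NNReal.coe_real_pi, ENNReal.toReal_ofReal (regulator_pos F).le,
    Real.mul_rpow hs0.le hN0.le] at h1
  have h2 : ∀ c : ℝ, c - (2 ^ nrRealPlaces F * (2 * π) ^ nrComplexPlaces F * regulator F) /
            (W * Real.sqrt |(discr F : ℝ)|) * s = (c * W -
      2 ^ nrRealPlaces F * π ^ nrComplexPlaces F * regulator F /
        (N * 2⁻¹ ^ nrComplexPlaces F * Real.sqrt |(discr F : ℝ)|) * (s * N)) / W := by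
    intro c
    rw [mul_pow, inv_pow]
    field_simp
  rw [h2, abs_div, abs_of_pos hW0, div_le_iff₀ hW0]
  refine h1.trans (le_of_eq ?_)
  field_simp

/-- The counting function of ideals has the residue of the Dedekind zeta function as its density,
with a power-saving error term. -/
theorem exists_abs_card_idealsLE_sub_le :
    ∃ B : ℝ, 0 ≤ B ∧ ∀ t : ℝ, 0 < t →
      |((idealsLE F t).card : ℝ) - dedekindZeta_residue F * t|
        ≤ B * t ^ (1 - 1 / (finrank ℚ F : ℝ)) := by
  classical
  choose B s₀ hB hs₀ H using exists_abs_card_class_sub_le F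
  set e : ℝ := 1 - 1 / (finrank ℚ F : ℝ) with he
  have hd1 : (1 : ℝ) ≤ finrank ℚ F := by exact_mod_cast (finrank_pos : 0 < finrank ℚ F)
  have he1 : e ≤ 1 := by
    have : 0 ≤ 1 / (finrank ℚ F : ℝ) := by positivity
    linarith
  have he0 : 0 ≤ e := by
    have : 1 / (finrank ℚ F : ℝ) ≤ 1 := by rw [div_le_one (by linarith)]; exact hd1
    linarith
  set c := dedekindZeta_residue F with hc
  have hc0 : 0 < c := dedekindZeta_residue_pos F
  have hcard : ∀ t : ℝ, ((idealsLE F t).card : ℝ) = ∑ C : ClassGroup (𝓞 F),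
      (Nat.card {I : (Ideal (𝓞 F))⁰ //
        absNorm (I : Ideal (𝓞 F)) ≤ t ∧ ClassGroup.mk0 I = C} : ℝ) := by
    intro t
    have hfin : Fintype {I : (Ideal (𝓞 F))⁰ // (absNorm (I : Ideal (𝓞 F)) : ℝ) ≤ t} := by
      refine @Fintype.ofFinite _ ?_
      refine Finite.of_injective (β := idealsLE F t)
        (fun I => ⟨I.1.1, (mem_idealsLE F t _).2 ⟨nonZeroDivisors.ne_zero I.1.2, I.2⟩⟩) ?_
      exact fun I I' h => Subtype.ext (Subtype.ext (congrArg (fun z : idealsLE F t => z.1) h))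
    let E := fun C : ClassGroup (𝓞 F) ↦ Equiv.subtypeSubtypeEquivSubtypeInter
      (fun I : (Ideal (𝓞 F))⁰ ↦ (absNorm I.1 : ℝ) ≤ t) (fun I ↦ ClassGroup.mk0 I = C)
    simp_rw [← Nat.card_congr (E _), Nat.card_eq_fintype_card, Fintype.subtype_card]
    rw [← Nat.cast_sum, ← Finset.card_eq_sum_card_fiberwise (s := (Finset.univ : Finset {I : (Ideal (𝓞 F))⁰ // (absNorm (I : Ideal (𝓞 F)) : ℝ) ≤ t}))
      (f := fun I ↦ ClassGroup.mk0 I.1) (t := Finset.univ) (fun _ _ ↦ Finset.mem_univ _), Nat.cast_inj]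
    refine (Finset.card_bij (fun I _ => I.1.1) ?_ ?_ ?_).symm
    · exact fun I _ => (mem_idealsLE F t _).2 ⟨nonZeroDivisors.ne_zero I.1.2, I.2⟩
    · exact fun I _ I' _ h => Subtype.ext (Subtype.ext h)
    · intro I hI
      rw [mem_idealsLE] at hI
      exact ⟨⟨⟨I, mem_nonZeroDivisors_of_ne_zero hI.1⟩, hI.2⟩, Finset.mem_univ _, rfl⟩
  have hcsum : ∀ t : ℝ, c * t = ∑ C : ClassGroup (𝓞 F),
      (2 ^ nrRealPlaces F * (2 * π) ^ nrComplexPlaces F * regulator F) /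
            (torsionOrder F * Real.sqrt |discr F|) * t := by
    intro t
    rw [Finset.sum_const, Finset.card_univ, nsmul_eq_mul, hc, dedekindZeta_residue_def,
      classNumber]
    ring
  -- Beyond `T` the bounds for all classes apply. On `[1, T)` a constant suffices, and below `1`
  -- there are no ideals and `t ≤ t ^ e`.
  set T := 1 + ∑ C, s₀ C with hT
  have hTs : ∀ C, s₀ C ≤ T := fun C => by
    have := Finset.single_le_sum (f := s₀) (fun i _ => (hs₀ i).le) (Finset.mem_univ C)
    linarith
  have hT1 : 1 ≤ T := by
    have := Finset.sum_nonneg fun C (_ : C ∈ Finset.univ) => (hs₀ C).le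
    linarith
  refine ⟨(∑ C, B C) + ((idealsLE F T).card + c * T), ?_, fun t ht => ?_⟩
  · have := Finset.sum_nonneg fun C (_ : C ∈ Finset.univ) => hB C
    positivity
  have hBs := Finset.sum_nonneg fun C (_ : C ∈ Finset.univ) => hB C
  have hte : 0 ≤ t ^ e := Real.rpow_nonneg ht.le _
  have hK : 0 ≤ ((idealsLE F T).card + c * T : ℝ) := by positivity
  rw [add_mul]
  rcases le_or_gt T t with h | h
  · refine le_add_of_le_of_nonneg ?_ (mul_nonneg hK hte)
    rw [hcard, hcsum, ← Finset.sum_sub_distrib, Finset.sum_mul]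
    exact (Finset.abs_sum_le_sum_abs _ _).trans
      (Finset.sum_le_sum fun C _ => H C t ((hTs C).trans h))
  refine le_add_of_nonneg_of_le (mul_nonneg hBs hte) ?_
  rcases lt_or_ge t 1 with h1 | h1
  · have h0 : idealsLE F t = ∅ := by
      refine Finset.eq_empty_of_forall_notMem fun I hI => ?_
      rw [mem_idealsLE] at hI
      have : (absNorm I : ℝ) < 1 := hI.2.trans_lt h1
      exact hI.1 (absNorm_eq_zero_iff.1 (Nat.lt_one_iff.1 (by exact_mod_cast this)))
    rw [h0, Finset.card_empty, Nat.cast_zero, zero_sub, abs_neg, abs_of_pos (by positivity)]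
    have h2 : t ≤ t ^ e := by
      conv_lhs => rw [← Real.rpow_one t]
      exact Real.rpow_le_rpow_of_exponent_ge ht h1.le he1
    calc c * t ≤ (c * T) * t ^ e := by
          gcongr
          nlinarith
      _ ≤ _ := by
          gcongr
          linarith [Nat.cast_nonneg (α := ℝ) (idealsLE F T).card]
  · have h2 : 1 ≤ t ^ e := Real.one_le_rpow h1 he0
    have h3 : ((idealsLE F t).card : ℝ) ≤ (idealsLE F T).card := by
      refine Nat.cast_le.2 (Finset.card_le_card fun I hI => ?_)
      rw [mem_idealsLE] at hI ⊢
      exact ⟨hI.1, hI.2.trans h.le⟩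
    calc _ ≤ ((idealsLE F T).card + c * T : ℝ) := by
          rw [abs_le]
          have h4 : c * t ≤ c * T := by gcongr
          have h5 : 0 < c * t := by positivity
          have h6 : (0 : ℝ) ≤ (idealsLE F t).card := Nat.cast_nonneg _
          constructor <;> linarith
      _ ≤ _ := le_mul_of_one_le_right hK h2

end IdealCount

/-! ### Continuation of the Dedekind zeta function and its residue. -/

section Residue

open MeasureTheory Set Ideal Asymptotics

variable (F : Type*) [Field F] [NumberField F]

theorem idealsLE_mono {s t : ℝ} (h : s ≤ t) : idealsLE F s ⊆ idealsLE F t := fun I hI => by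
  rw [mem_idealsLE] at hI ⊢
  exact ⟨hI.1, hI.2.trans h⟩

theorem one_le_absNorm {I : Ideal (𝓞 F)} (hI : I ≠ ⊥) : 1 ≤ absNorm I :=
  Nat.one_le_iff_ne_zero.2 fun h => hI (absNorm_eq_zero_iff.1 h)

theorem sum_idealsLE_eq_sum_Icc {M : Type*} [AddCommMonoid M] (g : ℕ → M) (t : ℝ) :
    ∑ I ∈ idealsLE F t, g (absNorm I) =
      ∑ k ∈ Finset.Icc 1 ⌊t⌋₊, Nat.card {I : Ideal (𝓞 F) // absNorm I = k} • g k := by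
  classical
  have hmaps : ∀ I ∈ idealsLE F t, absNorm I ∈ Finset.Icc 1 ⌊t⌋₊ := fun I hI => by
    rw [mem_idealsLE] at hI
    exact Finset.mem_Icc.2 ⟨one_le_absNorm F hI.1, Nat.le_floor hI.2⟩
  rw [← Finset.sum_fiberwise_of_maps_to hmaps]
  refine Finset.sum_congr rfl fun k hk => ?_
  rw [Finset.mem_Icc] at hk
  rw [Finset.sum_congr rfl (g := fun _ => g k) fun I hI => by rw [(Finset.mem_filter.1 hI).2],
    Finset.sum_const]
  congr 1
  refine (Nat.subtype_card _ fun I => ?_).symm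
  rw [Finset.mem_filter, mem_idealsLE, and_iff_right_iff_imp]
  rintro rfl
  exact ⟨fun h => by simp [h] at hk, (Nat.le_floor_iff' (Nat.one_le_iff_ne_zero.1 hk.1)).1 hk.2⟩

theorem card_idealsLE_eq_sum (t : ℝ) :
    (idealsLE F t).card =
      ∑ k ∈ Finset.Icc 1 ⌊t⌋₊, Nat.card {I : Ideal (𝓞 F) // absNorm I = k} := by
  have := sum_idealsLE_eq_sum_Icc F (fun _ => 1) t
  simpa using this

/-- The error term in the counting of ideals, cut off at `1`. -/
def countError (t : ℝ) : ℂ :=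
  (Ioi (1 : ℝ)).indicator
    (fun t : ℝ => (((idealsLE F t).card - dedekindZeta_residue F * t : ℝ) : ℂ)) t

theorem locallyIntegrable_countError : LocallyIntegrable (countError F) := by
  have h1 : LocallyIntegrable fun t : ℝ => ((idealsLE F t).card - dedekindZeta_residue F * t : ℝ) := by
    refine LocallyIntegrable.sub (Monotone.locallyIntegrable fun s t h => ?_)
      (Continuous.locallyIntegrable (by fun_prop))
    exact Nat.cast_le.2 (Finset.card_le_card (idealsLE_mono F h))
  refine LocallyIntegrable.indicator (fun x => ?_) measurableSet_Ioi
  obtain ⟨s, hs, h⟩ := h1 x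
  exact ⟨s, hs, Integrable.ofReal h⟩

theorem countError_isBigO_atTop :
    countError F =O[atTop] fun t : ℝ => t ^ (-(1 / (Module.finrank ℚ F : ℝ) - 1)) := by
  obtain ⟨B, hB, H⟩ := exists_abs_card_idealsLE_sub_le F
  refine IsBigO.of_bound B ?_
  filter_upwards [eventually_gt_atTop 1] with t ht
  have ht0 : 0 < t := by linarith
  rw [countError, indicator_of_mem (mem_Ioi.2 ht), Complex.norm_real, Real.norm_eq_abs, neg_sub,
    Real.norm_of_nonneg (by positivity)]
  exact H t ht0

/-- Because of the cut-off, every exponent is allowed at `0`, so only the growth at infinity limits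
the Mellin transform. -/
theorem countError_isBigO_zero (b : ℝ) :
    countError F =O[𝓝[>] 0] fun t : ℝ => t ^ (-b) := by
  refine IsBigO.of_bound 0 ?_
  filter_upwards [mem_nhdsWithin_of_mem_nhds (Iio_mem_nhds zero_lt_one)] with t ht
  rw [countError, indicator_of_notMem (by simpa using (le_of_lt ht : t ≤ 1))]
  simp

theorem mellinConvergent_countError {s : ℂ} (hs : 1 - 1 / (Module.finrank ℚ F : ℝ) < s.re) :
    MellinConvergent (countError F) (-s) :=
  mellinConvergent_of_isBigO_rpow ((locallyIntegrable_countError F).locallyIntegrableOn _)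
    (countError_isBigO_atTop F) (by rw [Complex.neg_re]; linarith)
    (countError_isBigO_zero F _) (sub_one_lt _)

theorem differentiableAt_mellin_countError {s : ℂ}
    (hs : 1 - 1 / (Module.finrank ℚ F : ℝ) < s.re) :
    DifferentiableAt ℂ (mellin (countError F)) (-s) :=
  mellin_differentiableAt_of_isBigO_rpow ((locallyIntegrable_countError F).locallyIntegrableOn _)
    (countError_isBigO_atTop F) (by rw [Complex.neg_re]; linarith)
    (countError_isBigO_zero F _) (sub_one_lt _)

theorem inv_finrank_mem_Ioc : 1 / (Module.finrank ℚ F : ℝ) ∈ Ioc (0 : ℝ) 1 := by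
  have : (1 : ℝ) ≤ Module.finrank ℚ F := by exact_mod_cast (Module.finrank_pos : 0 < Module.finrank ℚ F)
  exact ⟨by positivity, (div_le_one (by positivity)).2 this⟩

theorem exists_card_idealsLE_le : ∃ B : ℝ, 0 ≤ B ∧ ∀ t : ℝ, 0 ≤ t → ((idealsLE F t).card : ℝ) ≤ B * t := by
  obtain ⟨B, hB, H⟩ := exists_abs_card_idealsLE_sub_le F
  have hd := inv_finrank_mem_Ioc F
  have hc := dedekindZeta_residue_pos F
  refine ⟨B + dedekindZeta_residue F, by positivity, fun t ht => ?_⟩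
  rcases lt_or_ge t 1 with h | h
  · have h0 : idealsLE F t = ∅ := by
      refine Finset.eq_empty_of_forall_notMem fun I hI => ?_
      rw [mem_idealsLE] at hI
      have : (1 : ℝ) ≤ absNorm I := by exact_mod_cast one_le_absNorm F hI.1
      linarith
    rw [h0]
    simp only [Finset.card_empty, Nat.cast_zero]
    positivity
  · have h1 := (abs_le.1 (H t (by linarith))).2
    have h2 : t ^ (1 - 1 / (Module.finrank ℚ F : ℝ)) ≤ t := by
      conv_rhs => rw [← Real.rpow_one t]
      exact Real.rpow_le_rpow_of_exponent_le h (by linarith [hd.1])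
    nlinarith

/-- Partial summation gives `s` times the integral over `t > 1` of the counting function against `t
^ (-s - 1)`. Splitting off `c t` produces the polar term. -/
theorem dedekindZeta_eq_mellin {s : ℂ} (hs : 1 < s.re) :
    dedekindZeta F s = s * mellin (countError F) (-s) +
      dedekindZeta_residue F * s / (s - 1) := by
  have hd := inv_finrank_mem_Ioc F
  have hO : (fun n : ℕ => ∑ k ∈ Finset.Icc 1 n,
      (Nat.card {I : Ideal (𝓞 F) // absNorm I = k} : ℝ)) =O[atTop] fun n => (n : ℝ) ^ (1 : ℝ) := by
    obtain ⟨B, hB, H⟩ := exists_card_idealsLE_le F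
    refine IsBigO.of_bound B (Eventually.of_forall fun n => ?_)
    have := H n n.cast_nonneg
    rw [card_idealsLE_eq_sum, Nat.floor_natCast, Nat.cast_sum] at this
    rwa [Real.rpow_one, Real.norm_of_nonneg (Finset.sum_nonneg fun _ _ => Nat.cast_nonneg _),
      Real.norm_of_nonneg n.cast_nonneg]
  have h1 := LSeries_eq_mul_integral_of_nonneg
    (fun n => (Nat.card {I : Ideal (𝓞 F) // absNorm I = n} : ℝ)) zero_le_one hs hO
    fun n => Nat.cast_nonneg _
  have hI1 : IntegrableOn (fun t : ℝ => (t : ℂ) ^ (-s - 1) • countError F t) (Ioi 1) :=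
    (mellinConvergent_countError F (by linarith [hd.1])).mono_set (Ioi_subset_Ioi zero_le_one)
  have hs' : (-s).re < -1 := by rw [Complex.neg_re]; linarith
  have hI2 : IntegrableOn (fun t : ℝ => (dedekindZeta_residue F : ℂ) * (t : ℂ) ^ (-s)) (Ioi 1) :=
    (integrableOn_Ioi_cpow_of_lt hs' zero_lt_one).const_mul _
  have hm : mellin (countError F) (-s) =
      ∫ t in Ioi (1 : ℝ), (t : ℂ) ^ (-s - 1) • countError F t := by
    rw [mellin]
    refine setIntegral_eq_of_subset_of_forall_sdiff_eq_zero measurableSet_Ioi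
      (Ioi_subset_Ioi zero_le_one) fun t ht => ?_
    rw [countError, indicator_of_notMem ht.2, smul_zero]
  have hint : ∫ t in Ioi (1 : ℝ), (∑ k ∈ Finset.Icc 1 ⌊t⌋₊,
      (((Nat.card {I : Ideal (𝓞 F) // absNorm I = k} : ℝ)) : ℂ)) * (t : ℂ) ^ (-(s + 1)) =
      mellin (countError F) (-s) + dedekindZeta_residue F / (s - 1) := by
    have h2 : ∫ t in Ioi (1 : ℝ), (dedekindZeta_residue F : ℂ) * (t : ℂ) ^ (-s) =
        dedekindZeta_residue F / (s - 1) := by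
      rw [integral_const_mul, integral_Ioi_cpow_of_lt hs' zero_lt_one, Complex.ofReal_one,
        Complex.one_cpow, show -s + 1 = -(s - 1) by ring, neg_div_neg_eq, mul_one_div]
    rw [hm, ← h2, ← integral_add hI1 hI2]
    refine setIntegral_congr_fun measurableSet_Ioi fun t ht => ?_
    have ht0 : (t : ℂ) ≠ 0 := Complex.ofReal_ne_zero.2 (zero_lt_one.trans ht).ne'
    have hS : (∑ k ∈ Finset.Icc 1 ⌊t⌋₊,
        (((Nat.card {I : Ideal (𝓞 F) // absNorm I = k} : ℝ)) : ℂ)) = ((idealsLE F t).card : ℂ) := by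
      rw [card_idealsLE_eq_sum]; push_cast; rfl
    have hp : (t : ℂ) ^ (-s) = t ^ (-s - 1) * t := by
      conv_lhs => rw [show -s = (-s - 1) + 1 by ring, Complex.cpow_add _ _ ht0, Complex.cpow_one]
    simp only [countError, indicator_of_mem ht, smul_eq_mul]
    rw [hS, hp, show -(s + 1) = -s - 1 by ring]
    push_cast
    ring
  have h3 : dedekindZeta F s = LSeries (fun n => (((Nat.card {I : Ideal (𝓞 F) // absNorm I = n} : ℝ)) : ℂ)) s := by
    simp [dedekindZeta]
  rw [h3, h1, hint]
  ring

theorem isDedekindZetaResidue_dedekindZeta_residue :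
    IsDedekindZetaResidue F (dedekindZeta_residue F : ℂ) := by
  have hd := inv_finrank_mem_Ioc F
  have hopen : ∀ᶠ s : ℂ in 𝓝 1, 1 - 1 / (Module.finrank ℚ F : ℝ) < s.re :=
    (isOpen_lt continuous_const Complex.continuous_re).mem_nhds
      (by simpa using hd.1)
  have hdiff : ∀ᶠ s : ℂ in 𝓝 1, DifferentiableAt ℂ (fun s => s * mellin (countError F) (-s)) s := by
    filter_upwards [hopen] with s hs
    exact differentiableAt_id.mul
      ((differentiableAt_mellin_countError F hs).comp s differentiableAt_id.neg)
  have han : AnalyticAt ℂ (fun s : ℂ => s * mellin (countError F) (-s)) 1 :=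
    Complex.analyticAt_iff_eventually_differentiableAt.2 hdiff
  refine ⟨fun s => s * mellin (countError F) (-s) + dedekindZeta_residue F * s / (s - 1), ?_,
    fun s hs => (dedekindZeta_eq_mellin F hs).symm, ?_⟩
  · refine han.meromorphicAt.add (MeromorphicAt.div ?_ ?_) <;>
    · refine AnalyticAt.meromorphicAt ?_
      fun_prop
  · have h1 : Tendsto (fun s : ℂ => (s - 1) * (s * mellin (countError F) (-s)) +
        dedekindZeta_residue F * s) (𝓝 1) (𝓝 (dedekindZeta_residue F)) := by
      have : ContinuousAt (fun s : ℂ => (s - 1) * (s * mellin (countError F) (-s)) +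
        dedekindZeta_residue F * s) 1 := by
        refine ContinuousAt.add (ContinuousAt.mul (by fun_prop) han.continuousAt) (by fun_prop)
      simpa [ContinuousAt] using this
    refine (h1.mono_left nhdsWithin_le_nhds).congr' ?_
    filter_upwards [self_mem_nhdsWithin] with s hs
    have : s - 1 ≠ 0 := sub_ne_zero.2 hs
    field_simp

end Residue

/-! ### Divisor sums of ideals with the Möbius function. -/

section Convolution

open MeasureTheory Set Ideal UniqueFactorizationMonoid

variable (F : Type*) [Field F] [NumberField F]

/-- The pairs of ideals with product `a`, for `a ≠ 0`. -/
def divisorPairs (a : Ideal (𝓞 F)) : Finset (Ideal (𝓞 F) × Ideal (𝓞 F)) :=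
  commonDivisorPairs F a a

variable {F}

theorem mem_divisorPairs {a : Ideal (𝓞 F)} (ha : a ≠ ⊥) (p : Ideal (𝓞 F) × Ideal (𝓞 F)) :
    p ∈ divisorPairs F a ↔ p.1 * p.2 = a := by
  rw [divisorPairs, mem_commonDivisorPairs F a a ha, and_iff_left_iff_imp]
  exact fun h => ⟨p.2, h.symm⟩

theorem fst_ne_bot_of_mem_divisorPairs {a : Ideal (𝓞 F)} (ha : a ≠ ⊥)
    {p : Ideal (𝓞 F) × Ideal (𝓞 F)} (hp : p ∈ divisorPairs F a) : p.1 ≠ ⊥ := by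
  rw [mem_divisorPairs ha] at hp
  rintro h
  rw [h, Ideal.bot_mul] at hp
  exact ha hp.symm

theorem snd_ne_bot_of_mem_divisorPairs {a : Ideal (𝓞 F)} (ha : a ≠ ⊥)
    {p : Ideal (𝓞 F) × Ideal (𝓞 F)} (hp : p ∈ divisorPairs F a) : p.2 ≠ ⊥ := by
  rw [mem_divisorPairs ha] at hp
  rintro h
  rw [h, Ideal.mul_bot] at hp
  exact ha hp.symm

open scoped Classical in
theorem ramanujanSum_eq_sum_divisorPairs {a : Ideal (𝓞 F)} (ha : a ≠ ⊥) (b : Ideal (𝓞 F)) :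
    ramanujanSum F a b = ∑ p ∈ divisorPairs F a,
      if p.1 ∣ b then (absNorm p.1 : ℤ) * moebius p.2 else 0 := by
  rw [ramanujanSum, ← Finset.sum_filter]
  refine Finset.sum_congr ?_ fun _ _ => rfl
  ext p
  rw [mem_commonDivisorPairs F a b ha, Finset.mem_filter, mem_divisorPairs ha]

open scoped Classical in
theorem sum_idealsLE_dvd {d : Ideal (𝓞 F)} (hd : d ≠ ⊥) (g : Ideal (𝓞 F) → ℝ) (x : ℝ) :
    ∑ b ∈ idealsLE F x with d ∣ b, g b = ∑ b ∈ idealsLE F (x / absNorm d), g (d * b) := by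
  have hN : (0 : ℝ) < absNorm d := by exact_mod_cast one_le_absNorm F hd
  refine (Finset.sum_bij (fun b _ => d * b) ?_ ?_ ?_ fun _ _ => rfl).symm
  · intro b hb
    rw [mem_idealsLE] at hb
    rw [Finset.mem_filter, mem_idealsLE, map_mul, Nat.cast_mul, mul_comm (absNorm d : ℝ),
      ← le_div_iff₀ hN]
    exact ⟨⟨mul_ne_zero hd hb.1, hb.2⟩, dvd_mul_right _ _⟩
  · exact fun b _ b' _ h => mul_left_cancel₀ hd h
  · intro b hb
    rw [Finset.mem_filter, mem_idealsLE] at hb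
    obtain ⟨⟨hb0, hbx⟩, c, rfl⟩ := hb
    refine ⟨c, ?_, rfl⟩
    rw [map_mul, Nat.cast_mul, mul_comm (absNorm d : ℝ), ← le_div_iff₀ hN] at hbx
    exact (mem_idealsLE F _ _).2 ⟨right_ne_zero_of_mul hb0, hbx⟩

/-- Interchange the sums and substitute `𝔟 = 𝔡 𝔟'`. Both the series and the double sum start from
this. -/
theorem sum_ramanujanSum_mul {a : Ideal (𝓞 F)} (ha : a ≠ ⊥) (g : Ideal (𝓞 F) → ℝ) (x : ℝ) :
    ∑ b ∈ idealsLE F x, (ramanujanSum F a b : ℝ) * g b =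
      ∑ p ∈ divisorPairs F a, (absNorm p.1 : ℝ) * (moebius p.2 : ℤ) *
        ∑ b ∈ idealsLE F (x / absNorm p.1), g (p.1 * b) := by
  classical
  simp_rw [ramanujanSum_eq_sum_divisorPairs ha, Int.cast_sum, Finset.sum_mul]
  rw [Finset.sum_comm]
  refine Finset.sum_congr rfl fun p hp => ?_
  rw [← sum_idealsLE_dvd (fst_ne_bot_of_mem_divisorPairs ha hp), Finset.sum_filter,
    Finset.mul_sum]
  refine Finset.sum_congr rfl fun b _ => ?_
  split_ifs <;> simp

/-- Fix a prime `P` dividing `a = P a₀`. For `d e = a₀` with `P ∤ e`, the pairs `(P d, e)` and `(d,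
P e)` cancel. In every other pair `P ^ 2` divides the second entry. -/
theorem sum_moebius_divisorPairs {a : Ideal (𝓞 F)} (ha : a ≠ ⊥) (ha1 : a ≠ 1) :
    ∑ p ∈ divisorPairs F a, (moebius p.2 : ℤ) = 0 := by
  classical
  obtain ⟨P, hP, a₀, rfl⟩ : ∃ P : Ideal (𝓞 F), Prime P ∧ P ∣ a := by
    obtain ⟨P, hP, h⟩ := WfDvdMonoid.exists_irreducible_factor
      (fun h => ha1 ((Ideal.isUnit_iff.1 h).trans Ideal.one_eq_top.symm)) ha
    exact ⟨P, hP.prime, h⟩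
  have ha₀ : a₀ ≠ ⊥ := right_ne_zero_of_mul ha
  set T := (divisorPairs F a₀).filter fun p => ¬ P ∣ p.2 with hT
  let φ : Ideal (𝓞 F) × Ideal (𝓞 F) → Ideal (𝓞 F) × Ideal (𝓞 F) := fun p => (P * p.1, p.2)
  let ψ : Ideal (𝓞 F) × Ideal (𝓞 F) → Ideal (𝓞 F) × Ideal (𝓞 F) := fun p => (p.1, P * p.2)
  have hφ : Set.InjOn φ T := fun p _ q _ h => by
    simp only [φ, Prod.mk.injEq] at h
    exact Prod.ext (mul_left_cancel₀ hP.ne_zero h.1) h.2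
  have hψ : Set.InjOn ψ T := fun p _ q _ h => by
    simp only [ψ, Prod.mk.injEq] at h
    exact Prod.ext h.1 (mul_left_cancel₀ hP.ne_zero h.2)
  have hdisj : Disjoint (T.image φ) (T.image ψ) := by
    rw [Finset.disjoint_left]
    intro p hp hp'
    obtain ⟨q, hq, rfl⟩ := Finset.mem_image.1 hp
    obtain ⟨q', hq', h⟩ := Finset.mem_image.1 hp'
    simp only [φ, ψ, Prod.mk.injEq] at h
    exact (Finset.mem_filter.1 hq).2 ⟨_, h.2.symm⟩
  have hsub : T.image φ ∪ T.image ψ ⊆ divisorPairs F (P * a₀) := by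
    intro p hp
    rw [mem_divisorPairs ha]
    rcases Finset.mem_union.1 hp with h | h <;>
    · obtain ⟨q, hq, rfl⟩ := Finset.mem_image.1 h
      have h1 := (mem_divisorPairs ha₀ q).1 (Finset.mem_filter.1 hq).1
      simp only [φ, ψ, ← h1]
      ring
  rw [← Finset.sum_subset hsub, Finset.sum_union hdisj, Finset.sum_image hφ, Finset.sum_image hψ,
    ← Finset.sum_add_distrib]
  · refine Finset.sum_eq_zero fun p hp => ?_
    have hrel : IsRelPrime P p.2 :=
      (hP.irreducible.isRelPrime_iff_not_dvd).2 (Finset.mem_filter.1 hp).2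
    simp only [φ, ψ]
    rw [hrel.moebius_mul, hP.irreducible.moebius_eq]
    ring
  · rintro ⟨d, e⟩ hp hnot
    rw [mem_divisorPairs ha] at hp
    simp only at hp ⊢
    by_cases hPe : P ∣ e
    · obtain ⟨e', rfl⟩ := hPe
      have h1 : d * e' = a₀ := mul_left_cancel₀ hP.ne_zero (by rw [← hp]; ring)
      by_cases hPe' : P ∣ e'
      · obtain ⟨f, rfl⟩ := hPe'
        refine moebius_of_not_squarefree fun hsq => hP.not_isUnit (hsq P ⟨f, by ring⟩)
      · refine absurd (Finset.mem_union_right _ (Finset.mem_image.2 ⟨(d, e'), ?_, rfl⟩)) hnot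
        exact Finset.mem_filter.2 ⟨(mem_divisorPairs ha₀ _).2 h1, hPe'⟩
    · have hPd : P ∣ d := (hP.dvd_or_dvd ⟨a₀, hp⟩).resolve_right hPe
      obtain ⟨d', rfl⟩ := hPd
      have h1 : d' * e = a₀ := mul_left_cancel₀ hP.ne_zero (by rw [← hp]; ring)
      refine absurd (Finset.mem_union_left _ (Finset.mem_image.2 ⟨(d', e), ?_, rfl⟩)) hnot
      exact Finset.mem_filter.2 ⟨(mem_divisorPairs ha₀ _).2 h1, hPe⟩

theorem sum_moebius_mul_divisorPairs_prime_pow {P : Ideal (𝓞 F)} (hP : Prime P) (k : ℕ)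
    (f : Ideal (𝓞 F) → ℝ) :
    ∑ p ∈ divisorPairs F (P ^ (k + 1)), (moebius p.2 : ℤ) * f p.1 =
      f (P ^ (k + 1)) - f (P ^ k) := by
  classical
  have ha : P ^ (k + 1) ≠ ⊥ := pow_ne_zero _ hP.ne_zero
  have hP1 : P ≠ 1 := fun h => hP.not_isUnit (h ▸ isUnit_one)
  rw [← Finset.sum_subset (s₁ := {(P ^ (k + 1), 1), (P ^ k, P)})]
  · rw [Finset.sum_pair (fun h => hP1 (Prod.ext_iff.1 h).2.symm), moebius_one, hP.irreducible.moebius_eq]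
    push_cast
    ring
  · intro p hp
    rw [mem_divisorPairs ha]
    rcases Finset.mem_insert.1 hp with rfl | hp
    · simp
    · rw [Finset.mem_singleton.1 hp, pow_succ]
  · rintro ⟨d, e⟩ hp hnot
    rw [mem_divisorPairs ha] at hp
    simp only at hp ⊢
    obtain ⟨i, hi, hei⟩ := (dvd_prime_pow hP (k + 1)).1 ⟨d, by rw [← hp, mul_comm]⟩
    obtain rfl : e = P ^ i := associated_iff_eq.1 hei
    have hd : d = P ^ (k + 1 - i) := by
      refine mul_right_cancel₀ (pow_ne_zero i hP.ne_zero) ?_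
      rw [hp, ← pow_add, Nat.sub_add_cancel hi]
    have h2 : 2 ≤ i := by
      by_contra! h
      interval_cases i
      · simp [hd] at hnot
      · simp [hd] at hnot
    rw [moebius_of_not_squarefree, Int.cast_zero, zero_mul]
    intro hsq
    refine hP.not_isUnit (hsq P ?_)
    rw [← pow_two]
    exact pow_dvd_pow P h2

theorem abs_moebius_le_one (I : Ideal (𝓞 F)) : |((moebius I : ℤ) : ℝ)| ≤ 1 := by
  by_cases h : Squarefree I
  · rw [h.moebius_eq]; simp
  · rw [moebius_of_not_squarefree h]; simp

end Convolution

/-! ### Asymptotics of the harmonic sum over ideals. -/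

section Harmonic

open MeasureTheory Set Ideal

variable (F : Type*) [Field F] [NumberField F]

/-- The sum of `1 / 𝒩(𝔟)` over the nonzero ideals of norm at most `t`. -/
def idealHarmonic (t : ℝ) : ℝ := ∑ b ∈ idealsLE F t, 1 / (absNorm b : ℝ)

theorem idealHarmonic_sub_eq {u v : ℝ} (hu : 0 < u) (huv : u ≤ v) :
    idealHarmonic F v - idealHarmonic F u =
      v⁻¹ * (idealsLE F v).card - u⁻¹ * (idealsLE F u).card +
        ∫ t in u..v, (t ^ 2)⁻¹ * ((idealsLE F t).card : ℝ) ∧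
    IntervalIntegrable (fun t : ℝ => (t ^ 2)⁻¹ * ((idealsLE F t).card : ℝ)) volume u v := by
  -- Abel summation runs from `0`; the zero ideal has norm `0` and must be left out.
  let c : ℕ → ℝ := fun k => if k = 0 then 0 else Nat.card {I : Ideal (𝓞 F) // absNorm I = k}
  have hc : ∀ n : ℕ, ∀ g : ℕ → ℝ, ∑ k ∈ Finset.Icc 0 n, g k * c k = ∑ k ∈ Finset.Icc 1 n,
      g k * (Nat.card {I : Ideal (𝓞 F) // absNorm I = k} : ℝ) := by
    intro n g
    refine (Finset.sum_subset_zero_on_sdiff (Finset.Icc_subset_Icc_left zero_le_one) ?_ ?_).symm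
    · intro k hk
      rw [Finset.mem_sdiff, Finset.mem_Icc, Finset.mem_Icc] at hk
      have : k = 0 := by lia
      simp [c, this]
    · intro k hk
      have : k ≠ 0 := by rw [Finset.mem_Icc] at hk; lia
      simp [c, this]
  have hI : ∀ t : ℝ, ∑ k ∈ Finset.Icc 0 ⌊t⌋₊, c k = (idealsLE F t).card := by
    intro t
    have := hc ⌊t⌋₊ fun _ => 1
    simp only [one_mul] at this
    rw [this, card_idealsLE_eq_sum, Nat.cast_sum]
  have hH : ∀ t : ℝ, ∑ k ∈ Finset.Icc 0 ⌊t⌋₊, (k : ℝ)⁻¹ * c k = idealHarmonic F t := by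
    intro t
    rw [hc, idealHarmonic, sum_idealsLE_eq_sum_Icc F (fun n => 1 / (n : ℝ))]
    refine Finset.sum_congr rfl fun k _ => ?_
    rw [nsmul_eq_mul, one_div, mul_comm]
  have hne : ∀ t ∈ Set.Icc u v, t ≠ 0 := fun t ht => (hu.trans_le ht.1).ne'
  have hderiv : (deriv fun t : ℝ => t⁻¹) = fun t => -(t ^ 2)⁻¹ := by
    ext t; exact deriv_inv
  have hint : IntegrableOn (fun t : ℝ => (t ^ 2)⁻¹) (Set.Icc u v) := by
    refine ContinuousOn.integrableOn_Icc ?_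
    exact ContinuousOn.inv₀ (by fun_prop) fun t ht => pow_ne_zero _ (hne t ht)
  have habel := sum_mul_eq_sub_sub_integral_mul c hu.le huv (f := fun t => t⁻¹)
    (fun t ht => differentiableAt_inv (hne t ht)) (by rw [hderiv]; exact hint.neg)
  have hii := integrableOn_mul_sum_Icc c (m := 0) hu.le hint
  simp_rw [hI] at hii
  refine ⟨?_, (intervalIntegrable_iff_integrableOn_Icc_of_le huv).2 hii⟩
  have hsplit : ∑ k ∈ Finset.Icc 0 ⌊v⌋₊, (k : ℝ)⁻¹ * c k = ∑ k ∈ Finset.Icc 0 ⌊u⌋₊, (k : ℝ)⁻¹ * c k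
      + ∑ k ∈ Finset.Ioc ⌊u⌋₊ ⌊v⌋₊, (k : ℝ)⁻¹ * c k := by
    rw [← Finset.sum_union]
    · congr 1
      have := Nat.floor_le_floor huv
      ext k; simp only [Finset.mem_Icc, Finset.mem_union, Finset.mem_Ioc]; lia
    · rw [Finset.disjoint_left]
      intro k; simp only [Finset.mem_Icc, Finset.mem_Ioc]; lia
  rw [hH, hH, habel] at hsplit
  simp_rw [hI, hderiv, neg_mul] at hsplit
  rw [hsplit, intervalIntegral.integral_of_le huv, integral_neg]
  ring

/-- By Abel summation, the relative counting error, at most `B * u ^ (-1/d)` beyond `u`, enters once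
at each endpoint (the `2`) and once integrated against `1 / t` (the logarithm). -/
theorem exists_abs_idealHarmonic_sub_le :
    ∃ B : ℝ, 0 ≤ B ∧ ∀ u v : ℝ, 0 < u → u ≤ v →
      |idealHarmonic F v - idealHarmonic F u - dedekindZeta_residue F * Real.log (v / u)|
        ≤ B * u ^ (-(1 / (Module.finrank ℚ F : ℝ))) * (2 + Real.log (v / u)) := by
  obtain ⟨B, hB, H⟩ := exists_abs_card_idealsLE_sub_le F
  have hd := inv_finrank_mem_Ioc F
  set δ := 1 / (Module.finrank ℚ F : ℝ) with hδ
  set c := dedekindZeta_residue F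
  refine ⟨B, hB, fun u v hu huv => ?_⟩
  have hv : 0 < v := hu.trans_le huv
  have key : ∀ t, u ≤ t → |t⁻¹ * (idealsLE F t).card - c| ≤ B * u ^ (-δ) := by
    intro t ht
    have ht0 : 0 < t := hu.trans_le ht
    have h1 : t⁻¹ * (idealsLE F t).card - c = t⁻¹ * ((idealsLE F t).card - c * t) := by
      field_simp
    have h2 : t ^ (-δ) ≤ u ^ (-δ) := Real.rpow_le_rpow_of_nonpos hu ht (by linarith [hd.1])
    have h3 : t ^ (1 - δ) = t * t ^ (-δ) := by
      rw [sub_eq_add_neg, Real.rpow_add ht0, Real.rpow_one]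
    rw [h1, abs_mul, abs_of_pos (inv_pos.2 ht0), inv_mul_le_iff₀ ht0]
    calc _ ≤ B * t ^ (1 - δ) := H t ht0
      _ = t * (B * t ^ (-δ)) := by rw [h3]; ring
      _ ≤ _ := by gcongr
  obtain ⟨heq, hint⟩ := idealHarmonic_sub_eq F hu huv
  have hne : ∀ t ∈ Set.uIcc u v, t ≠ 0 := fun t ht => by
    rw [uIcc_of_le huv] at ht; exact (hu.trans_le ht.1).ne'
  have hinv : IntervalIntegrable (fun t : ℝ => t⁻¹) volume u v :=
    intervalIntegral.intervalIntegrable_inv (fun t ht => hne t ht) continuousOn_id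
  have hlog : ∫ t in u..v, t⁻¹ = Real.log (v / u) := integral_inv_of_pos hu hv
  have hbound : |∫ t in u..v, ((t ^ 2)⁻¹ * ((idealsLE F t).card : ℝ) - c * t⁻¹)| ≤
      B * u ^ (-δ) * Real.log (v / u) := by
    rw [← hlog, ← intervalIntegral.integral_const_mul, ← Real.norm_eq_abs]
    refine intervalIntegral.norm_integral_le_of_norm_le huv ?_ (hinv.const_mul _)
    refine Eventually.of_forall fun t ht => ?_
    have ht0 : 0 < t := hu.trans ht.1
    have h1 : (t ^ 2)⁻¹ * ((idealsLE F t).card : ℝ) - c * t⁻¹ =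
        (t⁻¹ * (idealsLE F t).card - c) * t⁻¹ := by field_simp
    rw [h1, Real.norm_eq_abs, abs_mul, abs_of_pos (inv_pos.2 ht0)]
    gcongr
    exact key t ht.1.le
  rw [intervalIntegral.integral_sub hint (hinv.const_mul _), intervalIntegral.integral_const_mul,
    hlog] at hbound
  have h1 := key u le_rfl
  have h2 := key v huv
  rw [abs_le] at h1 h2 hbound ⊢
  rw [heq, mul_add]
  constructor <;> linarith [h1.1, h1.2, h2.1, h2.2, hbound.1, hbound.2]

theorem tendsto_idealHarmonic_sub {q : ℝ} (hq : 1 ≤ q) :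
    Tendsto (fun u : ℝ => idealHarmonic F (q * u) - idealHarmonic F u) atTop
      (𝓝 (dedekindZeta_residue F * Real.log q)) := by
  obtain ⟨B, hB, H⟩ := exists_abs_idealHarmonic_sub_le F
  have hd := inv_finrank_mem_Ioc F
  rw [tendsto_iff_dist_tendsto_zero]
  have h0 : Tendsto (fun u : ℝ => B * u ^ (-(1 / (Module.finrank ℚ F : ℝ))) * (2 + Real.log q))
      atTop (𝓝 0) := by
    simpa using ((tendsto_rpow_neg_atTop hd.1).const_mul B).mul_const (2 + Real.log q)
  refine squeeze_zero' (Eventually.of_forall fun _ => dist_nonneg) ?_ h0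
  filter_upwards [eventually_gt_atTop 0] with u hu
  have h1 := H u (q * u) hu (le_mul_of_one_le_left hu.le hq)
  rwa [mul_div_assoc, div_self hu.ne', mul_one] at h1

theorem exists_idealHarmonic_le :
    ∃ B : ℝ, 0 ≤ B ∧ ∀ y : ℝ, 1 ≤ y → idealHarmonic F y ≤ B * (1 + Real.log y) := by
  obtain ⟨B, hB, H⟩ := exists_abs_idealHarmonic_sub_le F
  have hc := dedekindZeta_residue_pos F
  have h0 : 0 ≤ idealHarmonic F 1 := Finset.sum_nonneg fun _ _ => by positivity
  refine ⟨idealHarmonic F 1 + dedekindZeta_residue F + 2 * B, by positivity, fun y hy => ?_⟩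
  have h1 := (abs_le.1 (H 1 y one_pos hy)).2
  rw [Real.one_rpow, div_one] at h1
  have hl : 0 ≤ Real.log y := Real.log_nonneg hy
  nlinarith [mul_nonneg h0 hl, mul_nonneg hB hl]

end Harmonic

/-! ### The Ramanujan series of a prime power. -/

section PrimePower

open Ideal

variable {F : Type*} [Field F] [NumberField F]

/-- Only the cofactors `1` and `P` have nonzero Möbius value, which leaves a difference of two
harmonic sums whose arguments have the fixed ratio `absNorm P`. -/
theorem tendsto_sum_ramanujanSum_div {P : Ideal (𝓞 F)} (hP : Prime P) (k : ℕ) :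
    Tendsto (fun x : ℝ => ∑ b ∈ idealsLE F x,
      (ramanujanSum F (P ^ (k + 1)) b : ℝ) / (absNorm b : ℝ)) atTop
      (𝓝 (-(dedekindZeta_residue F * Real.log (absNorm P)))) := by
  have hq : (1 : ℝ) ≤ absNorm P := by exact_mod_cast one_le_absNorm F hP.ne_zero
  have hq0 : (0 : ℝ) < absNorm P := by linarith
  have ha : P ^ (k + 1) ≠ ⊥ := pow_ne_zero _ hP.ne_zero
  have heq : ∀ x : ℝ, ∑ b ∈ idealsLE F x,
      (ramanujanSum F (P ^ (k + 1)) b : ℝ) / (absNorm b : ℝ) =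
      -(idealHarmonic F (absNorm P * (x / (absNorm P : ℝ) ^ (k + 1))) -
        idealHarmonic F (x / (absNorm P : ℝ) ^ (k + 1))) := by
    intro x
    simp_rw [div_eq_mul_inv (G := ℝ) (ramanujanSum F _ _ : ℝ)]
    rw [sum_ramanujanSum_mul ha fun b => (absNorm b : ℝ)⁻¹]
    have h1 : ∀ p ∈ divisorPairs F (P ^ (k + 1)), (absNorm p.1 : ℝ) *
        (UniqueFactorizationMonoid.moebius p.2 : ℤ) * ∑ b ∈ idealsLE F (x / absNorm p.1),
          (absNorm (p.1 * b) : ℝ)⁻¹ = (UniqueFactorizationMonoid.moebius p.2 : ℤ) *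
          idealHarmonic F (x / absNorm p.1) := by
      intro p hp
      have hN : (absNorm p.1 : ℝ) ≠ 0 := Nat.cast_ne_zero.2
        (Nat.one_le_iff_ne_zero.1 (one_le_absNorm F (fst_ne_bot_of_mem_divisorPairs ha hp)))
      rw [idealHarmonic, Finset.mul_sum, Finset.mul_sum]
      refine Finset.sum_congr rfl fun b _ => ?_
      rw [map_mul, Nat.cast_mul, mul_inv, one_div]
      field_simp
    rw [Finset.sum_congr rfl h1,
      sum_moebius_mul_divisorPairs_prime_pow hP k fun d => idealHarmonic F (x / absNorm d),
      neg_sub]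
    congr 2
    · rw [map_pow, Nat.cast_pow]
    · rw [map_pow, Nat.cast_pow, pow_succ]
      field_simp
  simp_rw [heq]
  exact ((tendsto_idealHarmonic_sub F hq).comp
    (tendsto_id.atTop_div_const (by positivity))).neg

end PrimePower

/-! ### The double sum of Ramanujan sums. -/

section DoubleSum

open Ideal UniqueFactorizationMonoid

variable (F : Type*) [Field F] [NumberField F]

theorem sum_card_divisorPairs_le (y : ℝ) :
    ∑ a ∈ idealsLE F y, (divisorPairs F a).card ≤
      ∑ d ∈ idealsLE F y, (idealsLE F (y / absNorm d)).card := by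
  rw [← Finset.card_sigma, ← Finset.card_sigma]
  refine Finset.card_le_card_of_injOn (fun z => ⟨z.2.1, z.2.2⟩) ?_ ?_
  · rintro ⟨a, d, e⟩ hz
    simp only [Finset.coe_sigma, Set.mem_sigma_iff, Finset.mem_coe] at hz ⊢
    obtain ⟨ha, hp⟩ := hz
    rw [mem_idealsLE] at ha
    have hd := fst_ne_bot_of_mem_divisorPairs ha.1 hp
    have he := snd_ne_bot_of_mem_divisorPairs ha.1 hp
    rw [mem_divisorPairs ha.1] at hp
    simp only at hd he hp
    have hd1 : (1 : ℝ) ≤ absNorm d := by exact_mod_cast one_le_absNorm F hd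
    have he1 : (1 : ℝ) ≤ absNorm e := by exact_mod_cast one_le_absNorm F he
    have hle : (absNorm d : ℝ) * absNorm e ≤ y := by
      rw [← Nat.cast_mul, ← map_mul, hp]; exact ha.2
    rw [mem_idealsLE, mem_idealsLE, le_div_iff₀ (by linarith)]
    exact ⟨⟨hd, by nlinarith⟩, he, by linarith⟩
  · rintro ⟨a, d, e⟩ hz ⟨a', d', e'⟩ hz' h
    simp only [Finset.coe_sigma, Set.mem_sigma_iff, Finset.mem_coe] at hz hz' h
    rw [mem_divisorPairs ((mem_idealsLE F _ _).1 hz.1).1] at hz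
    rw [mem_divisorPairs ((mem_idealsLE F _ _).1 hz'.1).1] at hz'
    obtain ⟨h1, h2⟩ := Sigma.mk.inj h
    obtain rfl := h1
    obtain rfl := eq_of_heq h2
    obtain rfl : a = a' := hz.2.symm.trans hz'.2
    rfl

theorem exists_sum_card_divisorPairs_le :
    ∃ B : ℝ, 0 ≤ B ∧ ∀ y : ℝ, 1 ≤ y →
      ∑ a ∈ idealsLE F y, ((divisorPairs F a).card : ℝ) ≤ B * (y * (1 + Real.log y)) := by
  obtain ⟨B, hB, H⟩ := exists_card_idealsLE_le F
  obtain ⟨B', hB', H'⟩ := exists_idealHarmonic_le F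
  refine ⟨B * B', by positivity, fun y hy => ?_⟩
  calc ∑ a ∈ idealsLE F y, ((divisorPairs F a).card : ℝ)
      ≤ ∑ d ∈ idealsLE F y, ((idealsLE F (y / absNorm d)).card : ℝ) := by
        exact_mod_cast sum_card_divisorPairs_le F y
    _ ≤ ∑ d ∈ idealsLE F y, B * (y / absNorm d) :=
        Finset.sum_le_sum fun d _ => H _ (by positivity)
    _ = B * y * idealHarmonic F y := by
        rw [idealHarmonic, Finset.mul_sum]
        exact Finset.sum_congr rfl fun d _ => by ring
    _ ≤ B * y * (B' * (1 + Real.log y)) := by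
        gcongr
        exact H' y hy
    _ = _ := by ring

theorem sum_sum_moebius_divisorPairs {y : ℝ} (hy : 1 ≤ y) :
    ∑ a ∈ idealsLE F y, ∑ p ∈ divisorPairs F a, ((moebius p.2 : ℤ) : ℝ) = 1 := by
  have h10 : (1 : Ideal (𝓞 F)) ≠ ⊥ := one_ne_zero
  have h1 : (1 : Ideal (𝓞 F)) ∈ idealsLE F y := by
    rw [mem_idealsLE]
    exact ⟨h10, by simpa using hy⟩
  rw [Finset.sum_eq_single_of_mem 1 h1]
  · rw [Finset.sum_eq_single (1, 1)]
    · rw [moebius_one, Int.cast_one]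
    · intro p hp hne
      rw [mem_divisorPairs h10] at hp
      have h1 : p.1 = 1 := isUnit_iff_eq_one.1 (IsUnit.of_mul_eq_one _ hp)
      exact absurd (Prod.ext h1 (by rwa [h1, one_mul] at hp)) hne
    · intro h
      rw [mem_divisorPairs h10] at h
      exact absurd (one_mul (1 : Ideal (𝓞 F))) h
  · intro a ha hne
    rw [mem_idealsLE] at ha
    rw [← Int.cast_sum, sum_moebius_divisorPairs ha.1 hne, Int.cast_zero]

/-- For `N = 𝒩(𝔡) ≤ y`, one pair contributes an error `N * (x / N) ^ (1 - 1/d) = x ^ (1 - 1/d) * N ^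
(1/d)`, and there are `O(y (1 + log y))` pairs. -/
theorem exists_abs_sum_sum_ramanujanSum_sub_le :
    ∃ B : ℝ, 0 ≤ B ∧ ∀ x y : ℝ, 0 < x → 1 ≤ y →
      |(∑ b ∈ idealsLE F x, ∑ a ∈ idealsLE F y, (ramanujanSum F a b : ℝ))
          - dedekindZeta_residue F * x|
        ≤ B * (x ^ (1 - 1 / (Module.finrank ℚ F : ℝ)) *
          (y ^ (1 / (Module.finrank ℚ F : ℝ)) * (y * (1 + Real.log y)))) := by
  obtain ⟨B, hB, H⟩ := exists_abs_card_idealsLE_sub_le F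
  obtain ⟨B', hB', H'⟩ := exists_sum_card_divisorPairs_le F
  have hd := inv_finrank_mem_Ioc F
  set δ := 1 / (Module.finrank ℚ F : ℝ) with hδ
  set c := dedekindZeta_residue F with hc
  refine ⟨B * B', by positivity, fun x y hx hy => ?_⟩
  have hy0 : 0 < y := by linarith
  have hsum : ∑ b ∈ idealsLE F x, ∑ a ∈ idealsLE F y, (ramanujanSum F a b : ℝ) =
      ∑ a ∈ idealsLE F y, ∑ p ∈ divisorPairs F a,
        (absNorm p.1 : ℝ) * (moebius p.2 : ℤ) * (idealsLE F (x / absNorm p.1)).card := by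
    rw [Finset.sum_comm]
    refine Finset.sum_congr rfl fun a ha => ?_
    have h := sum_ramanujanSum_mul ((mem_idealsLE F _ _).1 ha).1 (fun _ => 1) x
    simpa using h
  have hmain : c * x = ∑ a ∈ idealsLE F y, ∑ p ∈ divisorPairs F a,
      c * x * ((moebius p.2 : ℤ) : ℝ) := by
    simp_rw [← Finset.mul_sum]
    rw [sum_sum_moebius_divisorPairs F hy, mul_one]
  rw [hsum, hmain, ← Finset.sum_sub_distrib]
  simp_rw [← Finset.sum_sub_distrib]
  have hterm : ∀ a ∈ idealsLE F y, ∀ p ∈ divisorPairs F a,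
      |(absNorm p.1 : ℝ) * (moebius p.2 : ℤ) * (idealsLE F (x / absNorm p.1)).card
        - c * x * ((moebius p.2 : ℤ) : ℝ)| ≤ B * x ^ (1 - δ) * y ^ δ := by
    intro a ha p hp
    rw [mem_idealsLE] at ha
    have hN1 : (1 : ℝ) ≤ absNorm p.1 := by
      exact_mod_cast one_le_absNorm F (fst_ne_bot_of_mem_divisorPairs ha.1 hp)
    have he1 : (1 : ℝ) ≤ absNorm p.2 := by
      exact_mod_cast one_le_absNorm F (snd_ne_bot_of_mem_divisorPairs ha.1 hp)
    have hNy : (absNorm p.1 : ℝ) ≤ y := by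
      refine le_trans ?_ ha.2
      rw [← (mem_divisorPairs ha.1 p).1 hp, map_mul, Nat.cast_mul]
      nlinarith
    set N : ℝ := ((absNorm p.1 : ℕ) : ℝ) with hN
    have hN0 : 0 < N := by linarith
    have h1 := H (x / N) (by positivity)
    have h2 : N * (moebius p.2 : ℤ) * (idealsLE F (x / N)).card - c * x * ((moebius p.2 : ℤ) : ℝ) =
        ((moebius p.2 : ℤ) : ℝ) * (N * ((idealsLE F (x / N)).card - c * (x / N))) := by
      field_simp
    have h3 : N * (x / N) ^ (1 - δ) = x ^ (1 - δ) * N ^ δ := by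
      rw [Real.div_rpow hx.le hN0.le, Real.rpow_sub hN0, Real.rpow_one]
      have : N ^ δ ≠ 0 := (Real.rpow_pos_of_pos hN0 _).ne'
      field_simp
    rw [h2, abs_mul, abs_mul, abs_of_pos hN0]
    calc _ ≤ 1 * (N * (B * (x / N) ^ (1 - δ))) := by
          gcongr
          exact abs_moebius_le_one _
      _ = B * x ^ (1 - δ) * N ^ δ := by rw [mul_assoc B, ← h3]; ring
      _ ≤ _ := by
          gcongr
  calc _ ≤ ∑ a ∈ idealsLE F y, ∑ p ∈ divisorPairs F a, B * x ^ (1 - δ) * y ^ δ :=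
        (Finset.abs_sum_le_sum_abs _ _).trans (Finset.sum_le_sum fun a ha =>
          (Finset.abs_sum_le_sum_abs _ _).trans (Finset.sum_le_sum (hterm a ha)))
    _ = (∑ a ∈ idealsLE F y, ((divisorPairs F a).card : ℝ)) * (B * x ^ (1 - δ) * y ^ δ) := by
        simp_rw [Finset.sum_const, nsmul_eq_mul, Finset.sum_mul]
    _ ≤ B' * (y * (1 + Real.log y)) * (B * x ^ (1 - δ) * y ^ δ) := by
        gcongr
        exact H' y hy
    _ = _ := by ring

theorem exists_forall_abs_sum_sum_ramanujanSum_sub_le {lam : ℝ}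
    (hlam : (Module.finrank ℚ F : ℝ) + 1 < lam) {A ε : ℝ} (hA : 0 < A) (hε : 0 < ε) :
    ∃ X : ℝ, ∀ x y : ℝ, X ≤ x → 1 ≤ y → y ^ lam ≤ A * x →
      |(∑ b ∈ idealsLE F x, ∑ a ∈ idealsLE F y, (ramanujanSum F a b : ℝ))
        - dedekindZeta_residue F * x| ≤ ε * x := by
  obtain ⟨B, hB, H⟩ := exists_abs_sum_sum_ramanujanSum_sub_le F
  have hd0 : (0 : ℝ) < Module.finrank ℚ F := Nat.cast_pos.2 Module.finrank_pos
  set d : ℝ := ((Module.finrank ℚ F : ℕ) : ℝ) with hd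
  have hlam0 : 0 < lam := by linarith
  -- The logarithm is absorbed into `y ^ η`. This `η` uses half of the slack in `lam > d + 1`, so
  -- that `y ^ (1/d + 1 + η) = (y ^ lam) ^ θ` with `θ < 1/d`; the saving is `x ^ (-κ)`.
  set η := (lam - (d + 1)) / (2 * d) with hη
  have hη0 : 0 < η := div_pos (by linarith) (by linarith)
  set θ := (1 / d + 1 + η) / lam with hθ
  have hθ0 : 0 < θ := by positivity
  set κ := 1 / d - θ with hκ
  have hκ0 : 0 < κ := by
    rw [hκ, sub_pos, hθ, div_lt_div_iff₀ hlam0 hd0, one_mul]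
    have h1 : (1 / d + 1 + η) * d = 1 + d + (lam - (d + 1)) / 2 := by
      rw [hη]; field_simp
    rw [h1]; linarith
  have hlim : Tendsto (fun x : ℝ => B * (A ^ θ * (1 + 1 / η)) * x ^ (-κ)) atTop (𝓝 0) := by
    simpa using (tendsto_rpow_neg_atTop hκ0).const_mul (B * (A ^ θ * (1 + 1 / η)))
  obtain ⟨X, hX⟩ := eventually_atTop.1 ((hlim.eventually_lt_const hε).and (eventually_gt_atTop 0))
  refine ⟨X, fun x y hxX hy hyx => ?_⟩
  obtain ⟨hsmall, hx⟩ := hX x hxX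
  have hy0 : 0 < y := by linarith
  have h1 : 1 + Real.log y ≤ (1 + 1 / η) * y ^ η := by
    have h2 := Real.log_le_rpow_div hy0.le hη0
    have h3 := Real.one_le_rpow hy hη0.le
    rw [add_mul, one_mul, one_div_mul_eq_div]
    linarith
  have h2 : y ^ (1 / d) * (y * y ^ η) = (y ^ lam) ^ θ := by
    rw [← Real.rpow_mul hy0.le, hθ, mul_div_cancel₀ _ hlam0.ne', Real.rpow_add hy0,
      Real.rpow_add hy0, Real.rpow_one, mul_assoc]
  have h3 : (y ^ lam) ^ θ ≤ A ^ θ * x ^ θ := by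
    rw [← Real.mul_rpow hA.le hx.le]
    exact Real.rpow_le_rpow (by positivity) hyx hθ0.le
  have h4 : x ^ (1 - 1 / d) * x ^ θ = x ^ (-κ) * x := by
    conv_rhs => rw [← Real.rpow_add_one hx.ne']
    rw [← Real.rpow_add hx]
    congr 1
    rw [hκ]; ring
  calc _ ≤ B * (x ^ (1 - 1 / d) * (y ^ (1 / d) * (y * (1 + Real.log y)))) := H x y hx hy
    _ ≤ B * (x ^ (1 - 1 / d) * (y ^ (1 / d) * (y * ((1 + 1 / η) * y ^ η)))) := by gcongr
    _ = B * (1 + 1 / η) * x ^ (1 - 1 / d) * (y ^ (1 / d) * (y * y ^ η)) := by ring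
    _ ≤ B * (1 + 1 / η) * x ^ (1 - 1 / d) * (A ^ θ * x ^ θ) := by rw [h2]; gcongr
    _ = B * (A ^ θ * (1 + 1 / η)) * (x ^ (1 - 1 / d) * x ^ θ) := by ring
    _ = B * (A ^ θ * (1 + 1 / η)) * x ^ (-κ) * x := by rw [h4]; ring
    _ ≤ ε * x := by gcongr

end DoubleSum

end NumberFieldRamanujan

end

theorem mainTheorem3 (F : Type*) [Field F] [NumberField F] :
    NumberFieldRamanujan.IsDedekindZetaResidue F (dedekindZeta_residue F : ℂ) ∧
    (∀ a : Ideal (𝓞 F), a ≠ ⊥ → NumberFieldRamanujan.vonMangoldt F a ≠ 0 →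
      ∃ S : ℝ,
        Tendsto (fun x : ℝ => ∑ b ∈ NumberFieldRamanujan.idealsLE F x,
          (NumberFieldRamanujan.ramanujanSum F a b : ℝ) / (Ideal.absNorm b : ℝ)) atTop (𝓝 S) ∧
        dedekindZeta_residue F = -(1 / NumberFieldRamanujan.vonMangoldt F a) * S) ∧
    (∀ lam : ℝ, (Module.finrank ℚ F : ℝ) + 1 < lam →
      ∀ A : ℝ, 0 < A → ∀ ε : ℝ, 0 < ε → ∃ X : ℝ, ∀ x y : ℝ, X ≤ x → 1 ≤ y → y ^ lam ≤ A * x →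
        |(∑ b ∈ NumberFieldRamanujan.idealsLE F x, ∑ a ∈ NumberFieldRamanujan.idealsLE F y,
          (NumberFieldRamanujan.ramanujanSum F a b : ℝ)) - dedekindZeta_residue F * x|
            ≤ ε * x) := by
  refine ⟨NumberFieldRamanujan.isDedekindZetaResidue_dedekindZeta_residue F, fun a _ hL => ?_,
    fun lam hlam A hA ε hε =>
      NumberFieldRamanujan.exists_forall_abs_sum_sum_ramanujanSum_sub_le F hlam hA hε⟩
  -- A nonzero `Λ` forces a prime power; it also makes `log 𝒩(𝔭)` nonzero, as the final division
  -- needs.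
  have hpow : IsPrimePow a := by
    by_contra h
    exact hL (by rw [NumberFieldRamanujan.vonMangoldt, if_neg h])
  obtain ⟨P, k, hP, hk, rfl⟩ := hpow
  obtain ⟨k, rfl⟩ := Nat.exists_eq_succ_of_ne_zero hk.ne'
  have hL' := NumberFieldRamanujan.vonMangoldt_prime_pow F P (Ideal.isPrime_of_prime hP)
    hP.ne_zero (k + 1) hk
  refine ⟨_, NumberFieldRamanujan.tendsto_sum_ramanujanSum_div hP k, ?_⟩
  rw [hL'] at hL
  rw [hL']
  field_simp
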